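/- Let $n\ge 1$. For a domain (nonempty connected open set) $D\subset\mathbb C^n$ let $k_D$ be its Kobayashi pseudodistance (normalized so that the Poincaré distance of the unit disc $\Delta$ satisfies $p(0,\zeta)=\operatorname{arctanh}|\zeta|$), and put $B_D^k(z,r)=\{w\in D: k_D(z,w)<r\}$ for $z\in D$ and $0\le r\le\infty$. The domain $D$ is Kobayashi hyperbolic if $k_D(z,w)>0$ for all $z\ne w$ in $D$, and taut if every sequence of holomorphic maps $\Delta\to D$ has a subsequence that either converges locally uniformly to a holomorphic map $\Delta\to D$ or is compactly divergent. A domain $\Omega\subset\mathbb C^n$ is homogeneous if its group of holomorphic automorphisms acts transitively on $\Omega$. For a Kobayashi hyperbolic domain $D\subset\mathbb C^n$, a bounded homogeneous domain $\Omega\subset\mathbb C^n$ and $z\in D$ set $$h_D^\Omega(z)=\inf\{1/r:\ 0<r<\infty,\ B_D^k(z,r)\subset f(\Omega)\text{ for some injective holomorphic } f:\Omega\to D\},\qquad e_D^\Omega(z)=\tanh\bigl(1/h_D^\Omega(z)\bigr),$$ with the conventions $1/0=\infty$, $\tanh\infty=1$ and $\operatorname{arctanh}1=\infty$. Theorem.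 Let $D\subset\mathbb C^n$ be a Kobayashi hyperbolic domain that is bounded or taut, and let $\Omega\subset\mathbb C^n$ be a bounded homogeneous domain. Then for every $z\in D$ there is an injective holomorphic map $f:\Omega\to D$ such that $$B_D^k\bigl(z,\operatorname{arctanh} e_D^\Omega(z)\bigr)\subset f(\Omega).$$ -/

import Mathlib

open Set Filter Topology
open scoped ENNReal ComplexConjugate

noncomputable section

namespace Fridman

/-- `ℂⁿ` with its Euclidean norm. -/
abbrev Cn (n : ℕ) : Type := EuclideanSpace ℂ (Fin n)

/-- The open unit disc in `ℂ`. -/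
abbrev disc : Set ℂ := Metric.ball (0 : ℂ) 1

/-- A domain: a nonempty connected open set. -/
def IsDomainSet {n : ℕ} (D : Set (Cn n)) : Prop := IsOpen D ∧ IsConnected D

/-- `f` restricts to a holomorphic map from `U` into `V`. -/
def HolMap {E F : Type*} [NormedAddCommGroup E] [NormedSpace ℂ E]
    [NormedAddCommGroup F] [NormedSpace ℂ F] (U : Set E) (V : Set F) (f : E → F) : Prop :=
  DifferentiableOn ℂ f U ∧ MapsTo f U V

/-- `f` restricts to an injective holomorphic map from `U` into `V`. -/
def InjHolMap {n : ℕ} (U V : Set (Cn n)) (f : Cn n → Cn n) : Prop :=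
  HolMap U V f ∧ InjOn f U

/-- `f` restricts to a holomorphic automorphism of `U`. -/
def IsAut {n : ℕ} (U : Set (Cn n)) (f : Cn n → Cn n) : Prop :=
  HolMap U U f ∧ ∃ g : Cn n → Cn n, HolMap U U g ∧ InvOn g f U U

/-- The group of holomorphic automorphisms of `U` acts transitively on `U`. -/
def IsHomogeneous {n : ℕ} (U : Set (Cn n)) : Prop :=
  ∀ p ∈ U, ∀ q ∈ U, ∃ f : Cn n → Cn n, IsAut U f ∧ f p = q

/-- The Poincaré distance of the unit disc, normalized by `p(0, ζ) = artanh |ζ|`. -/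
def poincareDist (a b : ℂ) : ℝ := Real.artanh ‖(a - b) / (1 - conj a * b)‖

/-- The infimum of the Poincaré distances `p(a, b)` over all holomorphic `φ` from the unit disc
into `D` with `φ a = z` and `φ b = w` (`∞` if there is no such disc). -/
def lempert {n : ℕ} (D : Set (Cn n)) (z w : Cn n) : ℝ≥0∞ :=
  sInf {t | ∃ φ : ℂ → Cn n, ∃ a ∈ disc, ∃ b ∈ disc,
    HolMap disc D φ ∧ φ a = z ∧ φ b = w ∧ t = ENNReal.ofReal (poincareDist a b)}

/-- The Kobayashi pseudodistance of `D`: the infimum of the lengths of the chains of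
holomorphic discs in `D` that join `z` to `w`. -/
def kobayashi {n : ℕ} (D : Set (Cn n)) (z w : Cn n) : ℝ≥0∞ :=
  sInf {t | ∃ (m : ℕ) (c : ℕ → Cn n), c 0 = z ∧ c m = w ∧
    t = ∑ i ∈ Finset.range m, lempert D (c i) (c (i + 1))}

/-- The Kobayashi ball in `D` with centre `z` and radius `r`; the radius may be infinite. -/
def kobBall {n : ℕ} (D : Set (Cn n)) (z : Cn n) (r : ℝ≥0∞) : Set (Cn n) :=
  {w | w ∈ D ∧ kobayashi D z w < r}

/-- Kobayashi hyperbolicity: the pseudodistance is a distance on `D`. -/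
def IsKobHyperbolic {n : ℕ} (D : Set (Cn n)) : Prop :=
  ∀ z ∈ D, ∀ w ∈ D, kobayashi D z w = 0 → z = w

/-- Tautness: every sequence of holomorphic maps from the unit disc into `D` has a subsequence
that converges locally uniformly to a holomorphic map into `D` or is compactly divergent. -/
def IsTaut {n : ℕ} (D : Set (Cn n)) : Prop :=
  ∀ φ : ℕ → ℂ → Cn n, (∀ j, HolMap disc D (φ j)) →
    ∃ s : ℕ → ℕ, StrictMono s ∧
      ((∃ ψ : ℂ → Cn n, HolMap disc D ψ ∧
          TendstoLocallyUniformlyOn (fun j => φ (s j)) ψ atTop disc) ∨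
        ∀ K : Set ℂ, IsCompact K → K ⊆ disc → ∀ L : Set (Cn n), IsCompact L → L ⊆ D →
          ∀ᶠ j in atTop, Disjoint (φ (s j) '' K) L)

/-- `h_D^Ω(z) = inf {1/r : B_D^k(z, r) ⊆ f(Ω), f : Ω → D injective holomorphic, 0 < r < ∞}`. -/
def fridmanH {n : ℕ} (D Ω : Set (Cn n)) (z : Cn n) : ℝ≥0∞ :=
  sInf {t | ∃ r : ℝ, 0 < r ∧ ∃ f : Cn n → Cn n, InjHolMap Ω D f ∧
    kobBall D z (ENNReal.ofReal r) ⊆ f '' Ω ∧ t = ENNReal.ofReal (1 / r)}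

/-- `tanh` on `[0, ∞]`, with `tanh ∞ = 1`. -/
def tanhExt (t : ℝ≥0∞) : ℝ := if t = ∞ then 1 else Real.tanh t.toReal

/-- `arctanh` on `[0, 1]`, with `arctanh 1 = ∞`. -/
def arctanhExt (x : ℝ) : ℝ≥0∞ := if x = 1 then ∞ else ENNReal.ofReal (Real.artanh x)

/-- The Fridman invariant `e_D^Ω(z) = tanh (1 / h_D^Ω(z))`, which is `1` if `h_D^Ω(z) = 0`. -/
def fridmanE {n : ℕ} (D Ω : Set (Cn n)) (z : Cn n) : ℝ := tanhExt (fridmanH D Ω z)⁻¹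

/-- `f` is an extremal map at `z` for the Fridman invariant. -/
def IsExtremalMap {n : ℕ} (D Ω : Set (Cn n)) (z : Cn n) (f : Cn n → Cn n) : Prop :=
  InjHolMap Ω D f ∧ kobBall D z (arctanhExt (fridmanE D Ω z)) ⊆ f '' Ω

end Fridman

end

/-! Choose competitors whose radii tend to R = 1/h, where h is the infimum defining the invariant.
Homogeneity of Ω allows precomposing them with automorphisms so that all send one point q to z. The
resulting maps `F j` are locally uniformly bounded: trivially if D is bounded, by chains of discs if
D is taut. They therefore have a holomorphic limit g along a nonprincipal ultrafilter.

The limit does not degenerate. The inverses of the `F j` live on a fixed ball about z and take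
values in the bounded set Ω, so Cauchy's estimate bounds their derivatives and makes g'(q)
invertible. By Osgood's theorem (`fderiv_injective_of_injOn`) the Jacobians of the `F j` never
vanish, and Hurwitz's theorem (`ne_zero_of_tendsto`) carries this from q to all of Ω. A quantitative
inverse function theorem then shows that g x lies in the image under `F j` of any neighbourhood of x
for most j. This gives injectivity and keeps the image of g inside D
(`LocallyBddHol.exists_injective_lim`).

It remains to cover the ball of radius R, which is connected (`isPreconnected_kobBall`). The
inverses converge to a point of Ω at z, and the danger is that elsewhere they run to the boundary of
Ω. Homogeneity excludes this (`tendsto_invFunOn_of_homogeneous`): automorphisms recentre the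
inverses at q, Cauchy's estimate keeps nearby values in a compact part of Ω, and the inverse
automorphisms themselves converge to an injective self-map of Ω. Convergence into Ω is thus an open
and closed condition on the ball. -/

namespace Fridman

open Metric

/-! ### Cauchy estimates and regularity in several variables -/

section Holomorphic

variable {E F : Type*} [NormedAddCommGroup E] [NormedSpace ℂ E]
  [NormedAddCommGroup F] [NormedSpace ℂ F]

/-- Cauchy's estimate on a half ball. -/
theorem norm_fderiv_le_of_norm_le {f : E → F} {x y : E} {ε M : ℝ} (hε : 0 < ε)
    (hf : DifferentiableOn ℂ f (ball x ε)) (hM : ∀ y ∈ ball x ε, ‖f y‖ ≤ M)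
    (hy : y ∈ ball x (ε / 2)) : ‖fderiv ℂ f y‖ ≤ 4 * M / ε := by
  have hsub : ball y (ε / 2) ⊆ ball x ε := by
    refine ball_subset_ball' ?_
    have := mem_ball.1 hy
    linarith
  have hyx : y ∈ ball x ε := hsub (mem_ball_self (by linarith))
  -- On the ball of radius ε/2 about y, f stays within 2M of f y; hence the bound 2M / (ε/2).
  have h := Complex.norm_fderiv_le_div_of_mapsTo_ball (c := y) (R₁ := ε / 2) (R₂ := 2 * M)
    (hf.mono hsub) (fun w hw => ?_) (by linarith)
  · refine h.trans (le_of_eq ?_)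
    field_simp
    ring
  · rw [mem_closedBall, dist_eq_norm]
    have := norm_sub_le (f w) (f y)
    have := hM w (hsub hw)
    have := hM y hyx
    linarith

theorem dist_le_of_norm_le {f : E → F} {x y y' : E} {ε M : ℝ} (hε : 0 < ε)
    (hf : DifferentiableOn ℂ f (ball x ε)) (hM : ∀ y ∈ ball x ε, ‖f y‖ ≤ M)
    (hy : y ∈ ball x (ε / 2)) (hy' : y' ∈ ball x (ε / 2)) :
    ‖f y - f y'‖ ≤ 4 * M / ε * ‖y - y'‖ := by
  refine (convex_ball x (ε / 2)).norm_image_sub_le_of_norm_fderiv_le (𝕜 := ℂ) (fun w hw => ?_)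
    (fun w hw => norm_fderiv_le_of_norm_le hε hf hM hw) hy' hy
  exact hf.differentiableAt (isOpen_ball.mem_nhds (ball_subset_ball (by linarith) hw))

variable [FiniteDimensional ℂ E] [FiniteDimensional ℂ F]

/-- The derivative along v is a Cauchy integral over a circle in the line y + ℂv, and this integral
may be differentiated under the integral sign because Cauchy's estimate dominates the integrand's
derivative. -/
theorem differentiableAt_fderiv_apply {f : E → F} {U : Set E} (hU : IsOpen U)
    (hf : DifferentiableOn ℂ f U) {x : E} (hx : x ∈ U) (v : E) :
    DifferentiableAt ℂ (fun y => fderiv ℂ f y v) x := by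
  have : CompleteSpace F := FiniteDimensional.complete ℂ F
  have : CompleteSpace E := FiniteDimensional.complete ℂ E
  have : ProperSpace E := FiniteDimensional.proper ℂ E
  obtain ⟨ε, hε, hεU⟩ : ∃ ε > 0, closedBall x ε ⊆ U :=
    nhds_basis_closedBall.mem_iff.1 (hU.mem_nhds hx)
  obtain ⟨M, hM⟩ : ∃ M, ∀ y ∈ closedBall x ε, ‖f y‖ ≤ M :=
    (isCompact_closedBall x ε).exists_bound_of_continuousOn (hf.continuousOn.mono hεU)
  have hfε : DifferentiableOn ℂ f (ball x ε) := hf.mono (ball_subset_closedBall.trans hεU)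
  have hMε : ∀ y ∈ ball x ε, ‖f y‖ ≤ M := fun y hy => hM y (ball_subset_closedBall hy)
  obtain ⟨r, hr, hrv⟩ : ∃ r > 0, r * ‖v‖ < ε / 4 := by
    refine ⟨ε / 4 / (‖v‖ + 1), by positivity, ?_⟩
    rw [div_mul_eq_mul_div, div_lt_iff₀ (by positivity)]
    nlinarith [norm_nonneg v]
  have hmem : ∀ y ∈ ball x (ε / 4), ∀ w ∈ closedBall (0 : ℂ) r, y + w • v ∈ ball x (ε / 2) := by
    intro y hy w hw
    rw [mem_ball, dist_eq_norm] at *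
    rw [mem_closedBall, dist_zero_right] at hw
    have h1 : y + w • v - x = (y - x) + w • v := by abel
    have h2 := norm_add_le (y - x) (w • v)
    rw [norm_smul] at h2
    have h3 : ‖w‖ * ‖v‖ ≤ r * ‖v‖ := by gcongr
    rw [h1]
    linarith
  have hmem' : ∀ y ∈ ball x (ε / 4), ∀ θ : ℝ, y + circleMap 0 r θ • v ∈ ball x (ε / 2) :=
    fun y hy θ => hmem y hy _ (circleMap_mem_closedBall 0 hr.le θ)
  have hdiff : ∀ y ∈ ball x (ε / 2), DifferentiableAt ℂ f y := fun y hy =>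
    hfε.differentiableAt (isOpen_ball.mem_nhds (ball_subset_ball (by linarith) hy))
  have key : ∀ y ∈ ball x (ε / 4), fderiv ℂ f y v =
      (2 * Real.pi * Complex.I : ℂ)⁻¹ • ∫ θ in (0 : ℝ)..2 * Real.pi,
        (deriv (circleMap 0 r) θ * ((circleMap 0 r θ - 0) ^ 2)⁻¹) •
          f (y + circleMap 0 r θ • v) := by
    intro y hy
    have hline : ∀ w : ℂ, HasDerivAt (fun w : ℂ => y + w • v) v w := fun w => by
      simpa using ((hasDerivAt_id w).smul_const v).const_add y
    have hO : IsOpen ((fun w : ℂ => y + w • v) ⁻¹' ball x (ε / 2)) :=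
      isOpen_ball.preimage (by fun_prop)
    have h := Complex.cderiv_eq_deriv (f := fun w : ℂ => f (y + w • v)) (z := 0) hO
      (fun w hw => ((hdiff _ hw).comp w (hline w).differentiableAt).differentiableWithinAt) hr
      (fun w hw => hmem y hy w hw)
    have h0 : deriv (fun w : ℂ => f (y + w • v)) 0 = fderiv ℂ f y v := by
      have hd : HasFDerivAt f (fderiv ℂ f y) (y + (0 : ℂ) • v) := by
        simpa using (hdiff y (ball_subset_ball (by linarith) hy)).hasFDerivAt
      exact (hd.comp_hasDerivAt (0 : ℂ) (hline 0)).deriv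
    rw [← h0, ← h, Complex.cderiv, circleIntegral]
    simp only [smul_smul]
  have hx4 : ball x (ε / 4) ∈ 𝓝 x := ball_mem_nhds x (by linarith)
  refine DifferentiableAt.congr_of_eventuallyEq ?_ (Filter.eventually_of_mem hx4 key)
  refine DifferentiableAt.const_smul ?_ _
  have hc : Continuous fun θ : ℝ =>
      deriv (circleMap 0 r) θ * ((circleMap 0 r θ - 0) ^ 2)⁻¹ := by
    simp only [deriv_circleMap]
    refine Continuous.mul (by fun_prop) (Continuous.inv₀ (by fun_prop) fun θ => ?_)
    simp [hr.ne']
  have hcont : ∀ y ∈ ball x (ε / 4), Continuous fun θ : ℝ =>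
      (deriv (circleMap 0 r) θ * ((circleMap 0 r θ - 0) ^ 2)⁻¹) • f (y + circleMap 0 r θ • v) := by
    intro y hy
    refine hc.smul (continuous_iff_continuousAt.2 fun θ => ?_)
    exact ContinuousAt.comp (f := fun θ : ℝ => y + circleMap 0 r θ • v)
      (hdiff _ (hmem' y hy θ)).continuousAt (by fun_prop)
  have hxx : x ∈ ball x (ε / 4) := mem_ball_self (by linarith)
  borelize E
  borelize F
  refine (intervalIntegral.hasFDerivAt_integral_of_dominated_of_fderiv_le (𝕜 := ℂ)
    (F' := fun y θ => (deriv (circleMap 0 r) θ * ((circleMap 0 r θ - 0) ^ 2)⁻¹) •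
      fderiv ℂ f (y + circleMap 0 r θ • v))
    (bound := fun θ => ‖deriv (circleMap 0 r) θ * ((circleMap 0 r θ - 0) ^ 2)⁻¹‖ * (4 * M / ε))
    hx4 ?_ ?_ ?_ ?_ ?_ ?_).differentiableAt
  · filter_upwards [hx4] with y hy using (hcont y hy).aestronglyMeasurable
  · exact (hcont x hxx).intervalIntegrable _ _
  · have : FiniteDimensional ℂ (E →L[ℂ] F) := inferInstance
    have : ProperSpace (E →L[ℂ] F) := FiniteDimensional.proper ℂ _
    refine hc.aestronglyMeasurable.smul ?_
    refine Measurable.aestronglyMeasurable ?_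
    exact (measurable_fderiv ℂ f).comp (Continuous.measurable (by fun_prop))
  · refine Eventually.of_forall fun θ _ y hy => ?_
    rw [norm_smul]
    gcongr
    exact norm_fderiv_le_of_norm_le hε hfε hMε (hmem' y hy θ)
  · exact (hc.norm.mul continuous_const).intervalIntegrable _ _
  · refine Eventually.of_forall fun θ _ y hy => ?_
    refine HasFDerivAt.const_smul ?_ _
    have h1 := (hdiff _ (hmem' y hy θ)).hasFDerivAt
    simpa [Function.comp_def] using h1.comp y ((hasFDerivAt_id y).add_const (circleMap 0 r θ • v))

theorem differentiableOn_fderiv {f : E → F} {U : Set E} (hU : IsOpen U)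
    (hf : DifferentiableOn ℂ f U) : DifferentiableOn ℂ (fderiv ℂ f) U := by
  intro x hx
  refine DifferentiableAt.differentiableWithinAt ?_
  have : CompleteSpace F := FiniteDimensional.complete ℂ F
  have : CompleteSpace E := FiniteDimensional.complete ℂ E
  let b := Module.finBasis ℂ E
  let e : (E →L[ℂ] F) ≃L[ℂ] (Fin (Module.finrank ℂ E) → F) :=
    (LinearMap.toContinuousLinearMap.symm.trans (b.constr ℂ).symm).toContinuousLinearEquiv
  have he : DifferentiableAt ℂ (fun y => e (fderiv ℂ f y)) x := by
    rw [differentiableAt_pi]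
    intro i
    exact differentiableAt_fderiv_apply hU hf hx (b i)
  have := e.symm.differentiableAt.comp x he
  simpa [Function.comp_def] using this

theorem hasStrictFDerivAt_of_differentiableOn {f : E → F} {U : Set E} (hU : IsOpen U)
    (hf : DifferentiableOn ℂ f U) {x : E} (hx : x ∈ U) :
    HasStrictFDerivAt f (fderiv ℂ f x) x := by
  refine hasStrictFDerivAt_of_hasFDerivAt_of_continuousAt (f' := fderiv ℂ f) ?_ ?_
  · filter_upwards [hU.mem_nhds hx] with y hy
    exact (hf.differentiableAt (hU.mem_nhds hy)).hasFDerivAt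
  · exact ((differentiableOn_fderiv hU hf).differentiableAt
      (hU.mem_nhds hx)).continuousAt

end Holomorphic

/-! ### One-variable tools, straightening, and Taylor expansion along lines -/

section Osgood

/-- If a holomorphic function is smaller at the centre of a disc than on the boundary circle, then
it has a zero in the disc. -/
theorem exists_zero_of_norm_lt_of_sphere {h : ℂ → ℂ} {c : ℂ} {r m : ℝ} (hr : 0 < r)
    (hd : DiffContOnCl ℂ h (ball c r)) (hm : ∀ ζ ∈ sphere c r, m ≤ ‖h ζ‖) (hc : ‖h c‖ < m) :
    ∃ ζ ∈ closedBall c r, h ζ = 0 := by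
  by_contra! hne
  have hm0 : 0 < m := (norm_nonneg _).trans_lt hc
  have hinv : DiffContOnCl ℂ h⁻¹ (ball c r) :=
    hd.inv fun ζ hζ => hne ζ (closure_ball_subset_closedBall hζ)
  have := Complex.norm_le_of_forall_mem_frontier_norm_le (C := m⁻¹) isBounded_ball hinv
    (fun ζ hζ => ?_) (subset_closure (mem_ball_self hr))
  · rw [Pi.inv_apply, norm_inv] at this
    have h0 : 0 < ‖h c‖ := norm_pos_iff.2 (hne c (mem_closedBall_self hr.le))
    exact absurd ((inv_le_inv₀ h0 hm0).1 this) (not_le.2 hc)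
  · rw [frontier_ball c hr.ne'] at hζ
    rw [Pi.inv_apply, norm_inv]
    exact inv_anti₀ hm0 (hm ζ hζ)

/-- An injective f is open, so its inverse g is continuous. Zeros of f' are isolated, so g is
holomorphic off f p, and the singularity at f p is removable. The chain rule for g ∘ f = id then
excludes f' = 0 at p. -/
theorem deriv_ne_zero_of_injOn {f : ℂ → ℂ} {U : Set ℂ} (hU : IsOpen U)
    (hf : DifferentiableOn ℂ f U) (hinj : InjOn f U) {p : ℂ} (hp : p ∈ U) : deriv f p ≠ 0 := by
  have hopen : ∀ x ∈ U, 𝓝 (f x) ≤ map f (𝓝 x) := by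
    intro x hx
    refine ((hf.analyticAt (hU.mem_nhds hx)).eventually_constant_or_nhds_le_map_nhds).resolve_left
      fun hc => ?_
    have h1 : ∀ᶠ y in 𝓝 x, y = x := by
      filter_upwards [hc, hU.mem_nhds hx] with y hy hyU using hinj hyU hx hy
    have h2 : ∀ᶠ y in 𝓝[≠] x, False := by
      filter_upwards [h1.filter_mono nhdsWithin_le_nhds, self_mem_nhdsWithin] with y h h'
      exact h' h
    exact (NeBot.ne inferInstance : 𝓝[≠] x ≠ ⊥) (eventually_false_iff_eq_bot.1 h2)
  set g := Function.invFunOn f U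
  have hgf : ∀ x ∈ U, g (f x) = x := fun x hx => hinj.leftInvOn_invFunOn hx
  have hgc : ∀ x ∈ U, ContinuousAt g (f x) := by
    intro x hx
    rw [ContinuousAt, hgf x hx]
    intro N hN
    refine hopen x hx ?_
    rw [mem_map]
    filter_upwards [hN, hU.mem_nhds hx] with y hy hyU
    rw [mem_preimage, mem_preimage, hgf y hyU]
    exact hy
  have hfg : ∀ x ∈ U, ∀ᶠ y in 𝓝 (f x), f (g y) = y := by
    intro x hx
    refine hopen x hx ?_
    rw [mem_map]
    filter_upwards [hU.mem_nhds hx] with y hyU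
    change f (g (f y)) = f y
    rw [hgf y hyU]
  have hderiv : ∀ᶠ x in 𝓝[≠] p, deriv f x ≠ 0 := by
    refine ((hf.analyticAt (hU.mem_nhds hp)).deriv.eventually_eq_zero_or_eventually_ne_zero
        ).resolve_left
      fun h0 => ?_
    obtain ⟨ε, hε, hεp⟩ := Metric.eventually_nhds_iff_ball.1 (h0.and (hU.mem_nhds hp))
    have hq : p + (ε / 2 : ℝ) ∈ ball p ε := by
      simp [abs_of_pos hε, hε]
    have hconst := (convex_ball p ε).is_const_of_fderivWithin_eq_zero (𝕜 := ℂ) (f := f)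
      (hf.mono fun y hy => (hεp y hy).2) (fun y hy => by
        rw [fderivWithin_of_isOpen isOpen_ball hy]
        ext
        simpa using (hεp y hy).1) hq (mem_ball_self hε)
    have := hinj (hεp _ hq).2 hp hconst
    simp [hε.ne'] at this
  obtain ⟨N, hN, hNp⟩ : ∃ N ∈ 𝓝 p, ∀ x ∈ N, x ∈ U ∧ (x ≠ p → deriv f x ≠ 0) := by
    rw [eventually_nhdsWithin_iff] at hderiv
    exact ⟨_, hderiv.and (hU.mem_nhds hp), fun x hx => ⟨hx.2, fun h => hx.1 h⟩⟩
  have hS : f '' N ∈ 𝓝 (f p) := hopen p hp (image_mem_map hN)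
  have hgd : DifferentiableOn ℂ g (f '' N) := by
    refine (Complex.differentiableOn_compl_singleton_and_continuousAt_iff hS).1
      ⟨?_, hgc p hp⟩
    rintro _ ⟨⟨x, hx, rfl⟩, hxp⟩
    have hxU := (hNp x hx).1
    have hne : x ≠ p := fun h => hxp (by rw [h]; rfl)
    refine (HasDerivAt.of_local_left_inverse (f := f) (f' := deriv f x) (hgc x hxU) ?_
      ((hNp x hx).2 hne) (hfg x hxU)).differentiableAt.differentiableWithinAt
    rw [hgf x hxU]
    exact (hf.differentiableAt (hU.mem_nhds hxU)).hasDerivAt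
  intro h0
  have h1 := (hgd.differentiableAt hS).hasDerivAt.comp p
    (hf.differentiableAt (hU.mem_nhds hp)).hasDerivAt
  have h2 : HasDerivAt (g ∘ f) 1 p := by
    refine (hasDerivAt_id p).congr_of_eventuallyEq ?_
    filter_upwards [hU.mem_nhds hp] with y hy using hgf y hy
  rw [h0, mul_zero] at h1
  exact zero_ne_one (h1.unique h2)

variable {E F : Type} [NormedAddCommGroup E] [NormedSpace ℂ E]
  [NormedAddCommGroup F] [NormedSpace ℂ F] [FiniteDimensional ℂ E] [FiniteDimensional ℂ F]

/-- A determinant function on linear maps between spaces of the same dimension. -/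
theorem exists_differentiable_det (h : Module.finrank ℂ E = Module.finrank ℂ F) :
    ∃ d : (E →L[ℂ] F) → ℂ, Differentiable ℂ d ∧ ∀ L, d L ≠ 0 ↔ Function.Injective L := by
  let A : F ≃ₗ[ℂ] E := LinearEquiv.ofFinrankEq F E h.symm
  let b := Module.finBasis ℂ E
  refine ⟨fun L => LinearMap.det (A.toLinearMap ∘ₗ (L : E →ₗ[ℂ] F)), ?_, fun L => ?_⟩
  · have hentry : ∀ i j, ContDiff ℂ 1 fun L : E →L[ℂ] F =>
        LinearMap.toMatrix b b (A.toLinearMap ∘ₗ (L : E →ₗ[ℂ] F)) i j := by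
      intro i j
      let φ : (E →L[ℂ] F) →ₗ[ℂ] ℂ :=
        { toFun := fun L => LinearMap.toMatrix b b (A.toLinearMap ∘ₗ (L : E →ₗ[ℂ] F)) i j
          map_add' := fun L L' => by simp [LinearMap.toMatrix_apply]
          map_smul' := fun c L => by simp [LinearMap.toMatrix_apply] }
      exact (LinearMap.toContinuousLinearMap φ).contDiff
    simp only [← LinearMap.det_toMatrix b, Matrix.det_apply]
    refine Differentiable.fun_sum fun σ _ => Differentiable.const_smul ?_ _
    exact (contDiff_prod (n := 1) fun i _ => hentry (σ i) i).differentiable one_ne_zero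
  · have h1 : Function.Injective (A.toLinearMap ∘ₗ (L : E →ₗ[ℂ] F)) ↔ Function.Injective L := by
      rw [LinearMap.coe_comp]
      exact A.injective.of_comp_iff _
    rw [← h1, ← LinearMap.ker_eq_bot, ← LinearMap.isUnit_iff_ker_eq_bot,
      LinearMap.isUnit_iff_isUnit_det, isUnit_iff_ne_zero]

/-- Holomorphic coordinates in which `u` is affine and which move points along `v` only. -/
theorem exists_straightening {u : E → ℂ} {U : Set E} (hU : IsOpen U)
    (hu : DifferentiableOn ℂ u U) {p v : E} (hp : p ∈ U) (hv : fderiv ℂ u p v = 1) :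
    ∃ e : OpenPartialHomeomorph E E, p ∈ e.source ∧ e.source ⊆ U ∧ e p = 0 ∧
      (∀ x, ∃ s : ℂ, e x = x - p + s • v) ∧
      (∀ x, fderiv ℂ u p (e x) = u x - u p) ∧
      DifferentiableOn ℂ e.symm e.target ∧
      HasFDerivAt e.symm (ContinuousLinearMap.id ℂ E) 0 := by
  have : CompleteSpace E := FiniteDimensional.complete ℂ E
  -- The multiple of v is chosen so that u'(p), which is 1 on v, takes the value u x - u p at Φ x.
  -- The correction vanishes to second order, so Φ'(p) is the identity.
  set Φ : E → E := fun x => x - p + (u x - u p - fderiv ℂ u p (x - p)) • v with hΦ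
  have hΦd : DifferentiableOn ℂ Φ U := by
    refine (differentiableOn_id.sub_const p).add (DifferentiableOn.smul_const ?_ v)
    refine (hu.sub_const _).sub ?_
    exact (fderiv ℂ u p).differentiable.differentiableOn.comp (differentiableOn_id.sub_const p)
      (mapsTo_univ _ _)
  have hΦp : HasStrictFDerivAt Φ (ContinuousLinearEquiv.refl ℂ E : E →L[ℂ] E) p := by
    have h1 := hasStrictFDerivAt_of_differentiableOn hU hΦd hp
    convert h1 using 1
    have h2 : HasFDerivAt Φ (ContinuousLinearMap.id ℂ E +
        (fderiv ℂ u p - (fderiv ℂ u p).comp (ContinuousLinearMap.id ℂ E)).smulRight v) p := by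
      have hup := (hu.differentiableAt (hU.mem_nhds hp)).hasFDerivAt
      refine ((hasFDerivAt_id p).sub_const p).add (HasFDerivAt.smul_const ?_ v)
      exact (hup.sub_const _).sub
        ((fderiv ℂ u p).hasFDerivAt.comp p ((hasFDerivAt_id p).sub_const p))
    rw [h2.fderiv]
    ext x
    simp
  set e₀ := hΦp.toOpenPartialHomeomorph Φ with he₀
  have hcoe : ∀ x, e₀ x = Φ x := fun x => rfl
  -- Restricting to points where Φ' is invertible makes the inverse holomorphic on the whole target,
  -- not only at 0.
  have hinv : ∀ᶠ x in 𝓝 p, fderiv ℂ Φ x ∈ range ((↑) : (E ≃L[ℂ] E) → (E →L[ℂ] E)) := by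
    have hc : ContinuousAt (fderiv ℂ Φ) p := ((differentiableOn_fderiv hU hΦd).differentiableAt
      (hU.mem_nhds hp)).continuousAt
    refine hc ?_
    rw [hΦp.hasFDerivAt.fderiv]
    exact ContinuousLinearEquiv.nhds _
  obtain ⟨V, hVsub, hVo, hpV⟩ := _root_.mem_nhds_iff.1 (hinv.and (hU.mem_nhds hp))
  set e := e₀.restrOpen V hVo with he
  have hΦ0 : Φ p = 0 := by simp [hΦ]
  have hsrc : e.source = e₀.source ∩ V := e₀.restrOpen_source V hVo
  have hps : p ∈ e.source := by
    rw [hsrc]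
    exact ⟨hΦp.mem_toOpenPartialHomeomorph_source, hpV⟩
  have hex : ∀ x, e x = Φ x := fun x => rfl
  have hsymm : ∀ y ∈ e.target, ∀ A : E ≃L[ℂ] E, (A : E →L[ℂ] E) = fderiv ℂ Φ (e.symm y) →
      HasFDerivAt e.symm (A.symm : E →L[ℂ] E) y := by
    intro y hy A hA
    refine e.hasFDerivAt_symm hy ?_
    have hx : e.symm y ∈ e.source := e.map_target hy
    rw [hsrc] at hx
    have := (hΦd.differentiableAt (hU.mem_nhds (hVsub hx.2).2)).hasFDerivAt
    rw [← hA] at this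
    exact this
  refine ⟨e, hps, ?_, by rw [hex, hΦ0], fun x => ⟨_, hex x⟩, fun x => ?_, ?_, ?_⟩
  · rw [hsrc]
    exact fun x hx => (hVsub hx.2).2
  · rw [hex, hΦ]
    simp only [map_add, map_smul, hv, smul_eq_mul, mul_one]
    ring
  · intro y hy
    have hx : e.symm y ∈ e.source := e.map_target hy
    rw [hsrc] at hx
    obtain ⟨A, hA⟩ := (hVsub hx.2).1
    exact (hsymm y hy A hA).differentiableAt.differentiableWithinAt
  · have h0 : (0 : E) ∈ e.target := by
      rw [← hΦ0, ← hex]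
      exact e.map_source hps
    have h0' : e.symm 0 = p := by
      rw [← hΦ0, ← hex]
      exact e.left_inv hps
    refine hsymm 0 h0 (ContinuousLinearEquiv.refl ℂ E) ?_
    rw [h0', hΦp.hasFDerivAt.fderiv]

/-- The derivative along a fixed vector. -/
noncomputable def dirDeriv (v : E) (h : E → ℂ) : E → ℂ := fun x => fderiv ℂ h x v

theorem differentiableOn_iterate_dirDeriv {h : E → ℂ} {U : Set E} (hU : IsOpen U)
    (hh : DifferentiableOn ℂ h U) (v : E) (m : ℕ) :
    DifferentiableOn ℂ ((dirDeriv v)^[m] h) U := by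
  induction m with
  | zero => exact hh
  | succ m ih =>
    rw [Function.iterate_succ_apply']
    exact fun x hx => (differentiableAt_fderiv_apply hU ih hx v).differentiableWithinAt

theorem iteratedDeriv_comp_line {h : E → ℂ} {U : Set E} (hU : IsOpen U)
    (hh : DifferentiableOn ℂ h U) (p v : E) (m : ℕ) {ζ : ℂ} (hζ : p + ζ • v ∈ U) :
    iteratedDeriv m (fun ζ : ℂ => h (p + ζ • v)) ζ = (dirDeriv v)^[m] h (p + ζ • v) := by
  induction m generalizing ζ with
  | zero => simp
  | succ m ih =>
    rw [iteratedDeriv_succ, Function.iterate_succ_apply']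
    have hO : IsOpen ((fun ζ : ℂ => p + ζ • v) ⁻¹' U) := hU.preimage (by fun_prop)
    have heq : iteratedDeriv m (fun ζ : ℂ => h (p + ζ • v)) =ᶠ[𝓝 ζ]
        fun ζ => (dirDeriv v)^[m] h (p + ζ • v) := by
      filter_upwards [hO.mem_nhds hζ] with ξ hξ using ih hξ
    rw [heq.deriv_eq]
    have hline : HasDerivAt (fun w : ℂ => p + w • v) v ζ := by
      simpa using ((hasDerivAt_id ζ).smul_const v).const_add p
    exact ((((differentiableOn_iterate_dirDeriv hU hh v m).differentiableAt
      (hU.mem_nhds hζ)).hasFDerivAt).comp_hasDerivAt ζ hline).deriv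

/-- Restrict h to the complex line through p and x: all Taylor coefficients at p vanish, and x sits
at parameter 1. -/
theorem eventually_eq_zero_of_dirDeriv {h : E → ℂ} {U : Set E} (hU : IsOpen U)
    (hh : DifferentiableOn ℂ h U) {p : E} (hp : p ∈ U)
    (h0 : ∀ v m, (dirDeriv v)^[m] h p = 0) : ∀ᶠ x in 𝓝 p, h x = 0 := by
  obtain ⟨ε, hε, hεU⟩ := Metric.mem_nhds_iff.1 (hU.mem_nhds hp)
  filter_upwards [ball_mem_nhds p hε] with x hx
  rcases eq_or_ne x p with rfl | hne
  · exact h0 0 0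
  set v := x - p with hv
  have hv0 : 0 < ‖v‖ := norm_pos_iff.2 (sub_ne_zero.2 hne)
  have hmem : ∀ ζ ∈ ball (0 : ℂ) (ε / ‖v‖), p + ζ • v ∈ ball p ε := by
    intro ζ hζ
    rw [mem_ball_zero_iff, lt_div_iff₀ hv0] at hζ
    simpa [norm_smul] using hζ
  have hd : DifferentiableOn ℂ (fun ζ : ℂ => h (p + ζ • v)) (ball 0 (ε / ‖v‖)) := by
    refine (hh.mono hεU).comp ?_ hmem
    fun_prop
  have h1 : (1 : ℂ) ∈ ball (0 : ℂ) (ε / ‖v‖) := by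
    rw [mem_ball_zero_iff, norm_one, lt_div_iff₀ hv0, one_mul]
    rwa [mem_ball, dist_eq_norm] at hx
  have ht := Complex.taylorSeries_eq_on_ball hd h1
  have hz : ∀ m, iteratedDeriv m (fun ζ : ℂ => h (p + ζ • v)) 0 = 0 := fun m => by
    rw [iteratedDeriv_comp_line hU hh p v m (by simpa using hp)]
    simpa using h0 v m
  simp only [hz] at ht
  simpa [hv] using ht.symm

end Osgood

/-! ### Osgood's theorem -/

section Osgood

variable {E F : Type} [NormedAddCommGroup E] [NormedSpace ℂ E]
  [NormedAddCommGroup F] [NormedSpace ℂ F] [FiniteDimensional ℂ E] [FiniteDimensional ℂ F]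

/-- The zero set of `h` contains a holomorphic curve through some point, provided that the ambient
dimension is at least two. -/
theorem exists_curve_in_zeros {h : E → ℂ} {U : Set E} (hU : IsOpen U)
    (hh : DifferentiableOn ℂ h U) (hdim : 1 < Module.finrank ℂ E) {p₀ : E} (hp₀ : p₀ ∈ U)
    (hhp₀ : h p₀ = 0) (hnz : ¬ ∀ᶠ x in 𝓝 p₀, h x = 0) :
    ∃ γ : ℂ → E, ∃ δ > 0, DifferentiableOn ℂ γ (ball 0 δ) ∧ InjOn γ (ball 0 δ) ∧
      ∀ s ∈ ball 0 δ, γ s ∈ U ∧ h (γ s) = 0 := by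
  classical
  -- The order m is minimal over all zeros of h in U and all directions. By minimality the
  -- derivative u of order m - 1 along v vanishes on the whole zero set, which therefore lies in the
  -- hypersurface u = 0, smooth near p because u'(p)v ≠ 0.
  have hex : ∃ m, ∃ p ∈ U, h p = 0 ∧ ∃ v, (dirDeriv v)^[m] h p ≠ 0 := by
    by_contra! hcon
    exact hnz (eventually_eq_zero_of_dirDeriv hU hh hp₀ fun v m => hcon m p₀ hp₀ hhp₀ v)
  obtain ⟨p, hp, hhp, v, hv⟩ := Nat.find_spec hex
  have hmin : ∀ k < Nat.find hex, ∀ x ∈ U, h x = 0 → (dirDeriv v)^[k] h x = 0 := by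
    intro k hk x hx hhx
    by_contra hne
    exact Nat.find_min hex hk ⟨x, hx, hhx, v, hne⟩
  obtain ⟨k, hk⟩ : ∃ k, Nat.find hex = k + 1 := by
    refine Nat.exists_eq_succ_of_ne_zero fun h0 => hv ?_
    rw [h0]
    exact hhp
  set c := (dirDeriv v)^[Nat.find hex] h p with hc
  set u : E → ℂ := fun x => c⁻¹ • (dirDeriv v)^[k] h x with hu
  have hkd := differentiableOn_iterate_dirDeriv hU hh v k
  have hud : DifferentiableOn ℂ u U := hkd.const_smul c⁻¹
  have huZ : ∀ x ∈ U, h x = 0 → u x = 0 := fun x hx hhx => by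
    simp [hu, hmin k (by omega) x hx hhx]
  have huv : fderiv ℂ u p v = 1 := by
    have h1 : fderiv ℂ u p = c⁻¹ • fderiv ℂ ((dirDeriv v)^[k] h) p :=
      ((hkd.differentiableAt (hU.mem_nhds hp)).hasFDerivAt.const_smul c⁻¹).fderiv
    have h2 : fderiv ℂ ((dirDeriv v)^[k] h) p v = c := by
      rw [hc, hk, Function.iterate_succ_apply']
      rfl
    rw [h1, smul_apply, h2, smul_eq_mul, inv_mul_cancel₀ hv]
  obtain ⟨e, hps, hsU, hep, hline, hue, hesymm, -⟩ := exists_straightening hU hud hp huv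
  -- A direction tangent to the hypersurface; this is where dimension at least two enters.
  obtain ⟨t, ht, ht0⟩ : ∃ t, fderiv ℂ u p t = 0 ∧ t ≠ 0 := by
    have hne : fderiv ℂ u p ≠ 0 := fun h0 => by simp [h0] at huv
    have hker := Module.Dual.finrank_ker_add_one_of_ne_zero (f := (fderiv ℂ u p : E →ₗ[ℂ] ℂ))
      (fun h0 => hne (by ext x; exact LinearMap.congr_fun h0 x))
    have hpos : 0 < Module.finrank ℂ (LinearMap.ker (fderiv ℂ u p : E →ₗ[ℂ] ℂ)) := by omega
    have := Module.finrank_pos_iff.1 hpos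
    obtain ⟨x, hx⟩ := exists_ne (0 : LinearMap.ker (fderiv ℂ u p : E →ₗ[ℂ] ℂ))
    exact ⟨x, x.2, fun h0 => hx (Subtype.ext h0)⟩
  have hO : IsOpen ((fun ζ : ℂ => p + ζ • v) ⁻¹' U) := hU.preimage (by fun_prop)
  have h0O : (0 : ℂ) ∈ (fun ζ : ℂ => p + ζ • v) ⁻¹' U := by simpa using hp
  have hsl : DifferentiableOn ℂ (fun ζ : ℂ => h (p + ζ • v)) ((fun ζ : ℂ => p + ζ • v) ⁻¹' U) :=
    hh.comp (by fun_prop) fun ζ hζ => hζ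
  have hnz : ∀ᶠ ζ in 𝓝[≠] (0 : ℂ), h (p + ζ • v) ≠ 0 := by
    refine ((hsl.analyticAt (hO.mem_nhds h0O)).eventually_eq_zero_or_eventually_ne_zero
        ).resolve_left
      fun h0 => hv ?_
    have h1 : (fun ζ : ℂ => h (p + ζ • v)) =ᶠ[𝓝 0] fun _ => 0 := h0
    have h2 := h1.iteratedDeriv_eq (Nat.find hex)
    rw [iteratedDeriv_comp_line hU hh p v _ h0O] at h2
    simpa [iteratedDeriv_const] using h2
  rw [eventually_nhdsWithin_iff] at hnz
  have hsrc : ∀ᶠ ζ in 𝓝 (0 : ℂ), p + ζ • v ∈ e.source := by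
    refine ContinuousAt.eventually_mem (f := fun ζ : ℂ => p + ζ • v) (by fun_prop) ?_
    simpa using e.open_source.mem_nhds hps
  obtain ⟨r, hr, hrs⟩ := nhds_basis_closedBall.eventually_iff.1 (hnz.and hsrc)
  obtain ⟨m, hm, hmr⟩ : ∃ m > 0, ∀ ζ ∈ sphere (0 : ℂ) r, m < ‖h (p + ζ • v)‖ := by
    have hcont : ContinuousOn (fun ζ : ℂ => ‖h (p + ζ • v)‖) (sphere 0 r) :=
      (hsl.continuousOn.mono fun ζ hζ =>
        hsU (hrs (sphere_subset_closedBall hζ)).2).norm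
    obtain ⟨ζ₀, hζ₀, hζm⟩ := (isCompact_sphere (0 : ℂ) r).exists_isMinOn
      (NormedSpace.sphere_nonempty.2 hr.le) hcont
    have hpos : 0 < ‖h (p + ζ₀ • v)‖ := norm_pos_iff.2
      ((hrs (sphere_subset_closedBall hζ₀)).1 (ne_of_mem_sphere hζ₀ hr.ne'))
    exact ⟨_, half_pos hpos, fun ζ hζ => (half_lt_self hpos).trans_le (hζm hζ)⟩
  have hhc : ∀ x ∈ e.source, ContinuousAt h x := fun x hx =>
    (hh.differentiableAt (hU.mem_nhds (hsU hx))).continuousAt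
  have hin : ∀ᶠ s in 𝓝 (0 : ℂ), ∀ ζ ∈ closedBall (0 : ℂ) r, p + s • t + ζ • v ∈ e.source := by
    refine (isCompact_closedBall _ _).eventually_forall_of_forall_eventually fun ζ hζ => ?_
    refine ContinuousAt.eventually_mem (f := fun q : ℂ × ℂ => p + q.1 • t + q.2 • v)
      (by fun_prop) ?_
    simpa using e.open_source.mem_nhds (hrs hζ).2
  have hsph : ∀ᶠ s in 𝓝 (0 : ℂ), ∀ ζ ∈ sphere (0 : ℂ) r, m < ‖h (p + s • t + ζ • v)‖ := by
    refine (isCompact_sphere _ _).eventually_forall_of_forall_eventually fun ζ hζ => ?_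
    have hca : ContinuousAt (fun q : ℂ × ℂ => ‖h (p + q.1 • t + q.2 • v)‖) ((0 : ℂ), ζ) := by
      refine ContinuousAt.norm (ContinuousAt.comp (f := fun q : ℂ × ℂ => p + q.1 • t + q.2 • v)
        ?_ (by fun_prop))
      simpa using hhc _ (hrs (sphere_subset_closedBall hζ)).2
    exact hca.eventually_const_lt (by simpa using hmr ζ hζ)
  have hcen : ∀ᶠ s in 𝓝 (0 : ℂ), ‖h (p + s • t)‖ < m := by
    have hca : ContinuousAt (fun s : ℂ => ‖h (p + s • t)‖) (0 : ℂ) := by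
      refine ContinuousAt.norm (ContinuousAt.comp (f := fun s : ℂ => p + s • t) ?_ (by fun_prop))
      simpa using hhc p hps
    exact hca.eventually_lt_const (by simpa [hhp] using hm)
  -- For small s the disc through p + st in direction v contains a zero of h. As u vanishes there
  -- and the chart only shifts along v, that zero has coordinate exactly st, so the chart curve
  -- consists of zeros.
  have hfin : ∀ᶠ s in 𝓝 (0 : ℂ), s • t ∈ e.target ∧ h (e.symm (s • t)) = 0 := by
    filter_upwards [hin, hsph, hcen] with s h1 h2 h3
    have hopen : IsOpen ((fun ζ : ℂ => p + s • t + ζ • v) ⁻¹' U) := hU.preimage (by fun_prop)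
    have hd : DifferentiableOn ℂ (fun ζ : ℂ => h (p + s • t + ζ • v))
        ((fun ζ : ℂ => p + s • t + ζ • v) ⁻¹' U) :=
      hh.comp (by fun_prop) fun ζ hζ => hζ
    obtain ⟨ζ, hζ, hζ0⟩ := exists_zero_of_norm_lt_of_sphere
      (h := fun ζ : ℂ => h (p + s • t + ζ • v)) hr
      ((hd.mono fun ζ hζ => hsU (h1 ζ (closure_ball_subset_closedBall hζ))).diffContOnCl)
      (fun ζ hζ => (h2 ζ hζ).le) (by simpa using h3)
    have hx := h1 ζ hζ
    obtain ⟨a, ha⟩ := hline (p + s • t + ζ • v)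
    have hu0 := hue (p + s • t + ζ • v)
    rw [huZ _ (hsU hx) hζ0, huZ p hp hhp, sub_zero, ha] at hu0
    have hea : e (p + s • t + ζ • v) = s • t := by
      have : ζ + a = 0 := by simpa [ht, huv] using hu0
      rw [ha, show p + s • t + ζ • v - p + a • v = s • t + (ζ + a) • v by module, this]
      simp
    rw [← hea]
    refine ⟨e.map_source hx, ?_⟩
    rw [e.left_inv hx]
    exact hζ0
  obtain ⟨δ, hδ, hδs⟩ := Metric.eventually_nhds_iff_ball.1 hfin
  refine ⟨fun s => e.symm (s • t), δ, hδ, ?_, ?_, ?_⟩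
  · exact hesymm.comp (by fun_prop) fun s hs => (hδs s hs).1
  · intro s hs s' hs' hss
    have := e.symm.injOn (hδs s hs).1 (hδs s' hs').1 hss
    exact smul_left_injective ℂ ht0 this
  · exact fun s hs => ⟨hsU (e.map_target (hδs s hs).1), (hδs s hs).2⟩

/-- **Osgood's theorem**: an injective holomorphic map between spaces of the same dimension has
injective derivative at every point. -/
theorem fderiv_injective_of_injOn (n : ℕ) :
    ∀ (E F : Type) [NormedAddCommGroup E] [NormedSpace ℂ E] [NormedAddCommGroup F]
      [NormedSpace ℂ F] [FiniteDimensional ℂ E] [FiniteDimensional ℂ F],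
      Module.finrank ℂ E = n → Module.finrank ℂ F = n → ∀ {f : E → F} {U : Set E}, IsOpen U →
      DifferentiableOn ℂ f U → InjOn f U → ∀ p ∈ U, Function.Injective (fderiv ℂ f p) := by
  induction n with
  | zero =>
    intro E F _ _ _ _ _ _ hE _ f U _ _ _ p _ x y _
    have := Module.finrank_zero_iff.1 hE
    exact Subsingleton.elim x y
  | succ n ih =>
    intro E F _ _ _ _ _ _ hE hF f U hU hf hinj p hp
    -- Where f' ≠ 0, one coordinate ℓ ∘ f can be straightened. On its level set f is injective into
    -- a translate of ker ℓ, one dimension lower, and any kernel vector of f'(q) is tangent to that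
    -- level set.
    have hnonzero : ∀ q ∈ U, fderiv ℂ f q ≠ 0 → Function.Injective (fderiv ℂ f q) := by
      intro q hq hne
      obtain ⟨v, hv⟩ : ∃ v, fderiv ℂ f q v ≠ 0 := by
        by_contra! hcon
        exact hne (ContinuousLinearMap.ext hcon)
      obtain ⟨ℓ, hℓ⟩ := SeparatingDual.exists_eq_one (R := ℂ) hv
      have hud : DifferentiableOn ℂ (fun x => ℓ (f x)) U :=
        ℓ.differentiable.comp_differentiableOn hf
      have hfq := (hf.differentiableAt (hU.mem_nhds hq)).hasFDerivAt
      have hu' : fderiv ℂ (fun x => ℓ (f x)) q = ℓ.comp (fderiv ℂ f q) :=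
        (ℓ.hasFDerivAt.comp q hfq).fderiv
      obtain ⟨e, hqs, hsU, heq, -, hue, hed, he0⟩ := exists_straightening hU hud hq
        (v := v) (by rw [hu']; exact hℓ)
      rw [hu'] at hue
      set K := LinearMap.ker (ℓ.comp (fderiv ℂ f q) : E →ₗ[ℂ] ℂ) with hK
      set N := LinearMap.ker (ℓ : F →ₗ[ℂ] ℂ) with hN
      have hKn : Module.finrank ℂ K = n := by
        have := Module.Dual.finrank_ker_add_one_of_ne_zero
          (f := (ℓ.comp (fderiv ℂ f q) : E →ₗ[ℂ] ℂ)) fun h0 => by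
            have := LinearMap.congr_fun h0 v
            simp [hℓ] at this
        rw [← hK] at this
        omega
      have hNn : Module.finrank ℂ N = n := by
        have := Module.Dual.finrank_ker_add_one_of_ne_zero
          (f := (ℓ : F →ₗ[ℂ] ℂ)) fun h0 => by
            have := LinearMap.congr_fun h0 (fderiv ℂ f q v)
            simp [hℓ] at this
        rw [← hN] at this
        omega
      let P : F →L[ℂ] N := LinearMap.toContinuousLinearMap
        (LinearMap.codRestrict N
          (LinearMap.id - (ℓ : F →ₗ[ℂ] ℂ).smulRight (fderiv ℂ f q v)) fun x => by
            simp [hN, hℓ])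
      have hP : ∀ x, ((P x : N) : F) = x - ℓ x • fderiv ℂ f q v := fun x => rfl
      have h0t : (0 : E) ∈ e.target := by
        rw [← heq]
        exact e.map_source hqs
      have he00 : e.symm 0 = q := by
        rw [← heq]
        exact e.left_inv hqs
      set g : K → N := fun t => P (f (e.symm t)) with hg
      have hgd : DifferentiableOn ℂ g ((↑) ⁻¹' e.target : Set K) := by
        refine P.differentiable.comp_differentiableOn (hf.comp (hed.comp ?_ fun t ht => ht) ?_)
        · exact K.subtypeL.differentiable.differentiableOn
        · exact fun t ht => hsU (e.map_target ht)
      have hgi : InjOn g ((↑) ⁻¹' e.target : Set K) := by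
        intro t ht t' ht' htt
        have hℓt : ∀ t : K, (t : E) ∈ e.target → ℓ (f (e.symm t)) = ℓ (f q) := by
          intro t ht
          have h1 := hue (e.symm t)
          rw [e.right_inv ht, show (ℓ.comp (fderiv ℂ f q)) (t : E) = 0 from t.2] at h1
          exact (sub_eq_zero.1 h1.symm)
        have h1 : f (e.symm t) - ℓ (f (e.symm t)) • fderiv ℂ f q v =
            f (e.symm t') - ℓ (f (e.symm t')) • fderiv ℂ f q v := by
          rw [← hP, ← hP]
          exact congrArg Subtype.val htt
        rw [hℓt t ht, hℓt t' ht', sub_left_inj] at h1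
        have h2 := hinj (hsU (e.map_target ht)) (hsU (e.map_target ht')) h1
        exact Subtype.ext (e.symm.injOn ht ht' h2)
      have hO : IsOpen ((↑) ⁻¹' e.target : Set K) := e.open_target.preimage continuous_subtype_val
      have hginj := ih K N hKn hNn hO hgd hgi 0 (by simpa using h0t)
      have hg' : HasFDerivAt g (P.comp ((fderiv ℂ f q).comp
          ((ContinuousLinearMap.id ℂ E).comp K.subtypeL))) 0 := by
        refine P.hasFDerivAt.comp (0 : K) (HasFDerivAt.comp (0 : K) ?_
          (HasFDerivAt.comp (0 : K) ?_ K.subtypeL.hasFDerivAt))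
        · simpa [he00] using hfq
        · simpa using he0
      rw [hg'.fderiv] at hginj
      rw [injective_iff_map_eq_zero]
      intro x hx
      have hxK : x ∈ K := by
        change ℓ (fderiv ℂ f q x) = 0
        rw [hx, map_zero]
      have : (⟨x, hxK⟩ : K) = 0 := by
        refine (injective_iff_map_eq_zero _).1 hginj _ ?_
        change P (fderiv ℂ f q x) = 0
        rw [hx, map_zero]
      exact congrArg Subtype.val this
    refine hnonzero p hp fun hp0 => ?_
    rcases Nat.eq_zero_or_pos n with rfl | hn
    · have : Nontrivial E := Module.finrank_pos_iff (R := ℂ).1 (by omega)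
      obtain ⟨v, hv⟩ := exists_ne (0 : E)
      let A : F ≃L[ℂ] ℂ := (LinearEquiv.ofFinrankEq F ℂ (by simp [hF])).toContinuousLinearEquiv
      have hline : HasDerivAt (fun w : ℂ => p + w • v) v 0 := by
        simpa using ((hasDerivAt_id (0 : ℂ)).smul_const v).const_add p
      have hO : IsOpen ((fun w : ℂ => p + w • v) ⁻¹' U) := hU.preimage (by fun_prop)
      refine deriv_ne_zero_of_injOn (f := fun w : ℂ => A (f (p + w • v))) hO ?_ ?_
        (p := 0) (by simpa using hp) ?_
      · exact A.differentiable.comp_differentiableOn (hf.comp (by fun_prop) fun w hw => hw)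
      · intro w hw w' hw' hww
        have := hinj hw hw' (A.injective hww)
        exact smul_left_injective ℂ hv (add_left_cancel this)
      · have hfp : HasFDerivAt f (fderiv ℂ f p) (p + (0 : ℂ) • v) := by
          simpa using (hf.differentiableAt (hU.mem_nhds hp)).hasFDerivAt
        have := (A : F →L[ℂ] ℂ).hasFDerivAt.comp_hasDerivAt (0 : ℂ)
          (hfp.comp_hasDerivAt (0 : ℂ) hline)
        simpa [hp0] using! this.deriv
    · obtain ⟨d, hd, hdinj⟩ := exists_differentiable_det (hE.trans hF.symm)
      have hntE : Nontrivial E := Module.finrank_pos_iff (R := ℂ).1 (by omega)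
      have hd0 : d 0 = 0 := by
        by_contra hne
        obtain ⟨v, hv⟩ := exists_ne (0 : E)
        exact hv ((hdinj 0).1 hne (by simp))
      -- Degenerate points thus have zero derivative, so f is constant along any curve of such
      -- points, against injectivity. The curve is a line if the Jacobian vanishes identically near
      -- p, and otherwise comes from `exists_curve_in_zeros`.
      have hZ : ∀ x ∈ U, d (fderiv ℂ f x) = 0 → fderiv ℂ f x = 0 := by
        intro x hx hdx
        by_contra hne
        exact (hdinj _).2 (hnonzero x hx hne) hdx
      have hconst : ∀ γ : ℂ → E, ∀ δ > 0, DifferentiableOn ℂ γ (ball 0 δ) →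
          InjOn γ (ball 0 δ) → (∀ s ∈ ball 0 δ, γ s ∈ U ∧ d (fderiv ℂ f (γ s)) = 0) → False := by
        intro γ δ hδ hγd hγi hγ
        have hs : ((δ / 2 : ℝ) : ℂ) ∈ ball (0 : ℂ) δ := by
          simp [abs_of_pos hδ, hδ]
        have h1 := (convex_ball (0 : ℂ) δ).is_const_of_fderivWithin_eq_zero (𝕜 := ℂ)
          (f := f ∘ γ) (hf.comp hγd fun s hs => (hγ s hs).1) (fun s hs => by
            rw [fderivWithin_of_isOpen isOpen_ball hs, fderiv_comp s
              (hf.differentiableAt (hU.mem_nhds (hγ s hs).1))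
              (hγd.differentiableAt (isOpen_ball.mem_nhds hs)), hZ _ (hγ s hs).1 (hγ s hs).2]
            simp) hs (mem_ball_self hδ)
        have h2 := hγi hs (mem_ball_self hδ)
          (hinj (hγ _ hs).1 (hγ _ (mem_ball_self hδ)).1 h1)
        simp [hδ.ne'] at h2
      by_cases hev : ∀ᶠ x in 𝓝 p, d (fderiv ℂ f x) = 0
      · obtain ⟨ε, hε, hεp⟩ := Metric.eventually_nhds_iff_ball.1 (hev.and (hU.mem_nhds hp))
        obtain ⟨v, hv⟩ := exists_ne (0 : E)
        have hv0 : 0 < ‖v‖ := norm_pos_iff.2 hv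
        refine hconst (fun s => p + s • v) (ε / ‖v‖) (by positivity) (by fun_prop)
          (fun s _ s' _ hss => smul_left_injective ℂ hv (add_left_cancel hss)) fun s hs => ?_
        have : p + s • v ∈ ball p ε := by
          rw [mem_ball_zero_iff, lt_div_iff₀ hv0] at hs
          simpa [norm_smul] using hs
        exact ⟨(hεp _ this).2, (hεp _ this).1⟩
      · obtain ⟨γ, δ, hδ, h1, h2, h3⟩ := exists_curve_in_zeros hU
          (hd.comp_differentiableOn (differentiableOn_fderiv hU hf)) (by omega) hp
          (by simp [hp0, hd0]) hev
        exact hconst γ δ hδ h1 h2 h3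

end Osgood

/-! ### Holomorphic inverses of injective maps -/

section Inverse

variable {E F : Type} [NormedAddCommGroup E] [NormedSpace ℂ E]
  [NormedAddCommGroup F] [NormedSpace ℂ F] [FiniteDimensional ℂ E] [FiniteDimensional ℂ F]

/-- An injective linear map between spaces of the same dimension as an equivalence. -/
theorem exists_equiv_of_injective (hfin : Module.finrank ℂ E = Module.finrank ℂ F)
    {L : E →L[ℂ] F} (hL : Function.Injective L) : ∃ A : E ≃L[ℂ] F, (A : E →L[ℂ] F) = L :=
  ⟨(LinearEquiv.ofInjectiveOfFinrankEq (L : E →ₗ[ℂ] F) hL hfin).toContinuousLinearEquiv, by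
    ext x
    rfl⟩

variable {f : E → F} {U : Set E}

theorem map_nhds_eq_of_injOn (hfin : Module.finrank ℂ E = Module.finrank ℂ F) (hU : IsOpen U)
    (hf : DifferentiableOn ℂ f U) (hinj : InjOn f U) {x : E} (hx : x ∈ U) :
    map f (𝓝 x) = 𝓝 (f x) := by
  have : CompleteSpace E := FiniteDimensional.complete ℂ E
  obtain ⟨A, hA⟩ := exists_equiv_of_injective hfin
    (fderiv_injective_of_injOn _ E F hfin rfl hU hf hinj x hx)
  have h := hasStrictFDerivAt_of_differentiableOn hU hf hx
  rw [← hA] at h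
  exact h.map_nhds_eq_of_equiv

theorem differentiableOn_invFunOn (hfin : Module.finrank ℂ E = Module.finrank ℂ F) (hU : IsOpen U)
    (hf : DifferentiableOn ℂ f U) (hinj : InjOn f U) :
    DifferentiableOn ℂ (Function.invFunOn f U) (f '' U) := by
  set g := Function.invFunOn f U
  have hgf : ∀ x ∈ U, g (f x) = x := fun x hx => hinj.leftInvOn_invFunOn hx
  rintro _ ⟨x, hx, rfl⟩
  have hmap := map_nhds_eq_of_injOn hfin hU hf hinj hx
  have hgc : ContinuousAt g (f x) := by
    rw [ContinuousAt, hgf x hx, ← hmap, tendsto_map'_iff]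
    refine tendsto_id.congr' ?_
    filter_upwards [hU.mem_nhds hx] with y hy using (hgf y hy).symm
  obtain ⟨A, hA⟩ := exists_equiv_of_injective hfin
    (fderiv_injective_of_injOn _ E F hfin rfl hU hf hinj x hx)
  have hfx : HasFDerivAt f (A : E →L[ℂ] F) (g (f x)) := by
    rw [hgf x hx, hA]
    exact (hf.differentiableAt (hU.mem_nhds hx)).hasFDerivAt
  refine (HasFDerivAt.of_local_left_inverse hgc hfx ?_).differentiableAt.differentiableWithinAt
  rw [← hmap, eventually_map]
  filter_upwards [hU.mem_nhds hx] with y hy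
  rw [hgf y hy]

end Inverse

/-! ### Limits of locally bounded families along an ultrafilter -/

section Families

variable {ι : Type*} {E F G : Type} [NormedAddCommGroup E] [NormedSpace ℂ E]
  [NormedAddCommGroup F] [NormedSpace ℂ F] [NormedAddCommGroup G] [NormedSpace ℂ G]

/-- The family `f` is holomorphic and bounded near every point of `U`, uniformly along `l`. -/
def LocallyBddHol (l : Filter ι) (f : ι → E → F) (U : Set E) : Prop :=
  ∀ x ∈ U, ∃ ε > 0, ∃ M : ℝ, ∀ᶠ j in l, DifferentiableOn ℂ (f j) (ball x ε) ∧
    ∀ y ∈ ball x ε, ‖f j y‖ ≤ M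

/-- This replaces the extraction of subsequences: one ultrafilter yields limits at all points
simultaneously. -/
theorem exists_tendsto_of_isCompact {X : Type*} [TopologicalSpace X] (l : Ultrafilter ι)
    {K : Set X} (hK : IsCompact K) {x : ι → X} (hx : ∀ᶠ j in l, x j ∈ K) :
    ∃ a ∈ K, Tendsto x l (𝓝 a) :=
  hK.ultrafilter_le_nhds (l.map x) (le_principal_iff.2 hx)

/-- Cauchy's estimate makes the family uniformly Lipschitz near x, so pointwise convergence
tolerates moving arguments. -/
theorem LocallyBddHol.tendsto_of_tendsto {l : Filter ι} {f : ι → E → F} {U : Set E}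
    (hf : LocallyBddHol l f U) {x : E} (hx : x ∈ U) {y : F}
    (hy : Tendsto (fun j => f j x) l (𝓝 y)) {a : ι → E} (ha : Tendsto a l (𝓝 x)) :
    Tendsto (fun j => f j (a j)) l (𝓝 y) := by
  obtain ⟨ε, hε, M, hM⟩ := hf x hx
  have h0 : Tendsto (fun j => 4 * M / ε * ‖a j - x‖) l (𝓝 0) := by
    have := (tendsto_iff_norm_sub_tendsto_zero.1 ha).const_mul (4 * M / ε)
    simpa using this
  have h1 : Tendsto (fun j => f j (a j) - f j x) l (𝓝 0) := by
    refine squeeze_zero_norm' ?_ h0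
    filter_upwards [hM, ha (ball_mem_nhds x (half_pos hε))] with j hj haj
    exact dist_le_of_norm_le hε hj.1 hj.2 haj (mem_ball_self (half_pos hε))
  simpa using h1.add hy

theorem LocallyBddHol.comp_left [FiniteDimensional ℂ F] {l : Filter ι} {f : ι → E → F} {U : Set E}
    (hf : LocallyBddHol l f U) {d : F → G} (hd : Differentiable ℂ d) :
    LocallyBddHol l (fun j x => d (f j x)) U := by
  have : ProperSpace F := FiniteDimensional.proper ℂ F
  intro x hx
  obtain ⟨ε, hε, M, hM⟩ := hf x hx
  obtain ⟨C, hC⟩ := (isCompact_closedBall (0 : F) M).exists_bound_of_continuousOn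
    hd.continuous.continuousOn
  refine ⟨ε, hε, C, ?_⟩
  filter_upwards [hM] with j hj
  exact ⟨hd.comp_differentiableOn hj.1, fun y hy => hC _ (by simpa using hj.2 y hy)⟩

theorem LocallyBddHol.exists_tendsto [FiniteDimensional ℂ F] {l : Ultrafilter ι} {f : ι → E → F}
    {U : Set E} (hf : LocallyBddHol l f U) {x : E} (hx : x ∈ U) :
    ∃ y, Tendsto (fun j => f j x) l (𝓝 y) := by
  have : ProperSpace F := FiniteDimensional.proper ℂ F
  obtain ⟨ε, hε, M, hM⟩ := hf x hx
  obtain ⟨y, -, hy⟩ := exists_tendsto_of_isCompact l (isCompact_closedBall (0 : F) M)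
    (x := fun j => f j x) (by
      filter_upwards [hM] with j hj
      simpa using hj.2 x (mem_ball_self hε))
  exact ⟨y, hy⟩

variable [FiniteDimensional ℂ E] [FiniteDimensional ℂ F]

theorem LocallyBddHol.fderiv {l : Filter ι} {f : ι → E → F} {U : Set E}
    (hf : LocallyBddHol l f U) : LocallyBddHol l (fun j => fderiv ℂ (f j)) U := by
  intro x hx
  obtain ⟨ε, hε, M, hM⟩ := hf x hx
  refine ⟨ε / 2, half_pos hε, 4 * M / ε, ?_⟩
  filter_upwards [hM] with j hj
  exact ⟨(differentiableOn_fderiv isOpen_ball hj.1).mono (ball_subset_ball (by linarith)),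
    fun y hy => norm_fderiv_le_of_norm_le hε hj.1 hj.2 hy⟩

/-- A second order estimate, uniform along `l`. -/
theorem LocallyBddHol.norm_sub_fderiv_le {l : Filter ι} {f : ι → E → F} {U : Set E}
    (hf : LocallyBddHol l f U) {x : E} (hx : x ∈ U) :
    ∃ ρ > 0, ∃ C ≥ 0, ∀ᶠ j in l, ∀ δ < ρ, ∀ y ∈ closedBall x δ, ∀ y' ∈ closedBall x δ,
      ‖f j y - f j y' - _root_.fderiv ℂ (f j) x (y - y')‖ ≤ C * δ * ‖y - y'‖ := by
  obtain ⟨ε, hε, M, hM⟩ := hf x hx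
  obtain ⟨ε', hε', M', hM'⟩ := hf.fderiv x hx
  refine ⟨min ε (ε' / 2), lt_min hε (half_pos hε'), |4 * M' / ε'|, abs_nonneg _, ?_⟩
  filter_upwards [hM, hM'] with j hj hj' δ hδ y hy y' hy'
  have hsub : closedBall x δ ⊆ ball x ε := closedBall_subset_ball (hδ.trans_le (min_le_left _ _))
  have hsub' : closedBall x δ ⊆ ball x (ε' / 2) :=
    closedBall_subset_ball (hδ.trans_le (min_le_right _ _))
  refine (convex_closedBall x δ).norm_image_sub_le_of_norm_fderiv_le' (𝕜 := ℂ) (fun w hw => ?_)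
    (fun w hw => ?_) hy' hy
  · exact hj.1.differentiableAt (isOpen_ball.mem_nhds (hsub hw))
  · refine (dist_le_of_norm_le hε' hj'.1 hj'.2 (hsub' hw) (mem_ball_self (half_pos hε'))).trans ?_
    have : ‖w - x‖ ≤ δ := by simpa [dist_eq_norm] using hw
    calc 4 * M' / ε' * ‖w - x‖ ≤ |4 * M' / ε'| * ‖w - x‖ := by gcongr; exact le_abs_self _
      _ ≤ |4 * M' / ε'| * δ := by gcongr

/-- The uniform second order estimate passes to the limit and leaves a remainder O(‖y - x‖²). -/
theorem LocallyBddHol.hasFDerivAt_lim {l : Filter ι} [l.NeBot] {f : ι → E → F} {U : Set E}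
    (hU : IsOpen U) (hf : LocallyBddHol l f U) {g : E → F}
    (hg : ∀ x ∈ U, Tendsto (fun j => f j x) l (𝓝 (g x))) {x : E} (hx : x ∈ U) {A : E →L[ℂ] F}
    (hA : Tendsto (fun j => _root_.fderiv ℂ (f j) x) l (𝓝 A)) : HasFDerivAt g A x := by
  obtain ⟨ρ, hρ, C, hC, hj⟩ := hf.norm_sub_fderiv_le hx
  refine HasFDerivAt.of_isLittleO ?_
  have hO : (fun y => g y - g x - A (y - x)) =O[𝓝 x] fun y => ‖y - x‖ ^ 2 := by
    refine Asymptotics.IsBigO.of_bound C ?_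
    filter_upwards [ball_mem_nhds x hρ, hU.mem_nhds hx] with y hy hyU
    have hlim : Tendsto (fun j => f j y - f j x - _root_.fderiv ℂ (f j) x (y - x)) l
        (𝓝 (g y - g x - A (y - x))) :=
      ((hg y hyU).sub (hg x hx)).sub 
        (((ContinuousLinearMap.apply ℂ F (y - x)).continuous.tendsto A).comp hA)
    refine le_of_tendsto hlim.norm ?_
    filter_upwards [hj] with j hj
    have := hj ‖y - x‖ (by simpa [dist_eq_norm] using hy) y (by simp [dist_eq_norm]) x (by simp)
    simpa [pow_two, mul_assoc] using this
  refine hO.trans_isLittleO ?_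
  have h2 : (fun y => ‖y - x‖ ^ 2) =o[𝓝 x] fun y => ‖y - x‖ := by
    have h3 : Tendsto (fun y => ‖y - x‖) (𝓝 x) (𝓝 0) := by
      have : ContinuousAt (fun y => ‖y - x‖) x := by fun_prop
      simpa [ContinuousAt] using this
    have := (Asymptotics.isLittleO_one_iff ℝ).2 h3
    simpa [pow_two] using this.mul_isBigO (Asymptotics.isBigO_refl (fun y => ‖y - x‖) (𝓝 x))
  exact h2.of_norm_right

theorem LocallyBddHol.differentiableOn_lim {l : Ultrafilter ι} {f : ι → E → F} {U : Set E}
    (hU : IsOpen U) (hf : LocallyBddHol l f U) {g : E → F}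
    (hg : ∀ x ∈ U, Tendsto (fun j => f j x) l (𝓝 (g x))) : DifferentiableOn ℂ g U := by
  intro x hx
  obtain ⟨A, hA⟩ := hf.fderiv.exists_tendsto hx
  exact (hf.hasFDerivAt_lim hU hg hx hA).differentiableAt.differentiableWithinAt

theorem LocallyBddHol.tendsto_fderiv {l : Ultrafilter ι} {f : ι → E → F} {U : Set E}
    (hU : IsOpen U) (hf : LocallyBddHol l f U) {g : E → F}
    (hg : ∀ x ∈ U, Tendsto (fun j => f j x) l (𝓝 (g x))) {x : E} (hx : x ∈ U) :
    Tendsto (fun j => _root_.fderiv ℂ (f j) x) l (𝓝 (_root_.fderiv ℂ g x)) := by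
  obtain ⟨A, hA⟩ := hf.fderiv.exists_tendsto hx
  rwa [(hf.hasFDerivAt_lim hU hg hx hA).fderiv]

/-- **Hurwitz's theorem**: a limit of nowhere vanishing holomorphic functions on a connected open
set vanishes nowhere or everywhere. -/
theorem ne_zero_of_tendsto {l : Ultrafilter ι} {h : ι → E → ℂ} {U : Set E} (hU : IsOpen U)
    (hUc : IsPreconnected U) (hd : ∀ j, DifferentiableOn ℂ (h j) U) (hb : LocallyBddHol l h U)
    (hne : ∀ j, ∀ x ∈ U, h j x ≠ 0) {g : E → ℂ}
    (hg : ∀ x ∈ U, Tendsto (fun j => h j x) l (𝓝 (g x))) {q : E} (hq : q ∈ U) (hgq : g q ≠ 0) :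
    ∀ x ∈ U, g x ≠ 0 := by
  have hgd : DifferentiableOn ℂ g U := hb.differentiableOn_lim hU hg
  -- A zero of g is interior to the zero set. Otherwise, on a line through x it is isolated, so |g|
  -- > m on a small circle. Then `h j` is at least m on that circle and below m at its centre, which
  -- forces a zero of `h j`.
  have hlocal : ∀ x ∈ U, g x = 0 → ∃ ε > 0, ball x ε ⊆ U ∧ ∀ y ∈ ball x ε, g y = 0 := by
    intro x hx hgx
    obtain ⟨ε, hε, hεU⟩ := Metric.mem_nhds_iff.1 (hU.mem_nhds hx)
    refine ⟨ε, hε, hεU, fun y hy => ?_⟩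
    by_contra hgy
    set v := y - x with hv
    set O : Set ℂ := (fun ζ : ℂ => x + ζ • v) ⁻¹' ball x ε with hO
    have hOo : IsOpen O := isOpen_ball.preimage (by fun_prop)
    have hOc : Convex ℝ O := by
      intro a ha b hb s t hs ht hst
      have := convex_ball x ε ha hb hs ht hst
      have heq : s • (x + a • v) + t • (x + b • v) = x + (s • a + t • b) • v := by
        rw [smul_add, smul_add, add_smul, smul_assoc, smul_assoc]
        have : s • x + t • x = x := by rw [← add_smul, hst, one_smul]
        rw [add_add_add_comm, this]
      rwa [heq] at this
    have h0 : (0 : ℂ) ∈ O := by simp [hO, hε]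
    have h1 : (1 : ℂ) ∈ O := by simpa [hO, hv] using hy
    have hk : DifferentiableOn ℂ (fun ζ : ℂ => g (x + ζ • v)) O :=
      (hgd.mono hεU).comp (by fun_prop) fun ζ hζ => hζ
    have hnz : ∀ᶠ ζ in 𝓝[≠] (0 : ℂ), g (x + ζ • v) ≠ 0 := by
      refine ((hk.analyticAt (hOo.mem_nhds h0)).eventually_eq_zero_or_eventually_ne_zero
        ).resolve_left
        fun hz => hgy ?_
      have := (hk.analyticOnNhd hOo).eqOn_zero_of_preconnected_of_eventuallyEq_zero
        hOc.isPreconnected h0 hz h1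
      simpa [hv] using this
    rw [eventually_nhdsWithin_iff] at hnz
    obtain ⟨r, hr, hrs⟩ := nhds_basis_closedBall.eventually_iff.1 (hnz.and (hOo.mem_nhds h0))
    have hrU : ∀ ζ ∈ closedBall (0 : ℂ) r, x + ζ • v ∈ U := fun ζ hζ => hεU (hrs hζ).2
    obtain ⟨m, hm, hmr⟩ : ∃ m > 0, ∀ ζ ∈ sphere (0 : ℂ) r, m < ‖g (x + ζ • v)‖ := by
      have hcont : ContinuousOn (fun ζ : ℂ => ‖g (x + ζ • v)‖) (sphere 0 r) :=
        (hk.continuousOn.mono fun ζ hζ => (hrs (sphere_subset_closedBall hζ)).2).norm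
      obtain ⟨ζ₀, hζ₀, hζm⟩ := (isCompact_sphere (0 : ℂ) r).exists_isMinOn
        (NormedSpace.sphere_nonempty.2 hr.le) hcont
      have hpos : 0 < ‖g (x + ζ₀ • v)‖ := norm_pos_iff.2
        ((hrs (sphere_subset_closedBall hζ₀)).1 (ne_of_mem_sphere hζ₀ hr.ne'))
      exact ⟨_, half_pos hpos, fun ζ hζ => (half_lt_self hpos).trans_le (hζm hζ)⟩
    -- If this failed, bad points on the circle would converge along `l` to a point where |g| ≤ m.
    have hsph : ∀ᶠ j in l, ∀ ζ ∈ sphere (0 : ℂ) r, m ≤ ‖h j (x + ζ • v)‖ := by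
      by_contra hcon
      rw [← Ultrafilter.eventually_not] at hcon
      have hcon' : ∀ᶠ j in l, ∃ ζ ∈ sphere (0 : ℂ) r, ‖h j (x + ζ • v)‖ < m := by
        filter_upwards [hcon] with j hj
        by_contra! hj'
        exact hj hj'
      obtain ⟨ζ, hζ⟩ := hcon'.choice
      obtain ⟨a, ha, hζa⟩ := exists_tendsto_of_isCompact l (isCompact_sphere (0 : ℂ) r)
        (hζ.mono fun j hj => hj.1)
      have haU := hrU a (sphere_subset_closedBall ha)
      have hlim := hb.tendsto_of_tendsto haU (hg _ haU)
        ((hζa.smul_const v).const_add x)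
      exact absurd (le_of_tendsto hlim.norm (hζ.mono fun j hj => hj.2.le)) (not_le.2 (hmr a ha))
    have hcen : ∀ᶠ j in l, ‖h j x‖ < m := by
      have := (hg x hx).norm
      rw [hgx, norm_zero] at this
      exact this.eventually_lt_const hm
    obtain ⟨j, hj1, hj2⟩ := (hsph.and hcen).exists
    have hopen : IsOpen ((fun ζ : ℂ => x + ζ • v) ⁻¹' U) := hU.preimage (by fun_prop)
    have hdj : DifferentiableOn ℂ (fun ζ : ℂ => h j (x + ζ • v))
        ((fun ζ : ℂ => x + ζ • v) ⁻¹' U) := (hd j).comp (by fun_prop) fun ζ hζ => hζ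
    obtain ⟨ζ, hζ, hζ0⟩ := exists_zero_of_norm_lt_of_sphere
      (h := fun ζ : ℂ => h j (x + ζ • v)) hr
      ((hdj.mono fun ζ hζ => hrU ζ (closure_ball_subset_closedBall hζ)).diffContOnCl)
      hj1 (by simpa using hj2)
    exact hne j _ (hrU ζ hζ) hζ0
  intro x hx hgx
  have hV : IsOpen (U ∩ g ⁻¹' {0}ᶜ) :=
    hgd.continuousOn.isOpen_inter_preimage hU isOpen_compl_singleton
  have hZ : IsOpen (U ∩ g ⁻¹' {0}) := by
    rw [isOpen_iff_mem_nhds]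
    rintro y ⟨hy, hgy⟩
    obtain ⟨ε, hε, hεU, hε0⟩ := hlocal y hy hgy
    filter_upwards [ball_mem_nhds y hε] with w hw using ⟨hεU hw, hε0 w hw⟩
  obtain ⟨y, -, hy1, hy2⟩ := hUc _ _ hV hZ (fun y hy => by
    by_cases hgy : g y = 0
    · exact Or.inr ⟨hy, hgy⟩
    · exact Or.inl ⟨hy, hgy⟩) ⟨q, hq, hq, hgq⟩ ⟨x, hx, hx, hgx⟩
  exact hy1.2 hy2.2

/-- If `f j` converges and the limit has invertible derivative at `x`, then every neighbourhood of
`x` is eventually mapped by `f j` onto a set that contains the limit value at `x`. -/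
theorem LocallyBddHol.eventually_mem_image {l : Ultrafilter ι} {f : ι → E → F} {U : Set E}
    (hU : IsOpen U) (hf : LocallyBddHol l f U) {g : E → F}
    (hg : ∀ x ∈ U, Tendsto (fun j => f j x) l (𝓝 (g x))) {x : E} (hx : x ∈ U) {A : E ≃L[ℂ] F}
    (hA : (A : E →L[ℂ] F) = _root_.fderiv ℂ g x) {N : Set E} (hN : N ∈ 𝓝 x) :
    ∀ᶠ j in l, g x ∈ f j '' N := by
  have : CompleteSpace E := FiniteDimensional.complete ℂ E
  obtain ⟨ρ, hρ, C, hC, hj⟩ := hf.norm_sub_fderiv_le hx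
  obtain ⟨ε, hε, hεN⟩ := nhds_basis_closedBall.mem_iff.1 hN
  set κ : NNReal := ‖(A.symm : F →L[ℂ] E)‖₊ + 1 with hκ
  have hκ0 : (0 : ℝ) < κ := by positivity
  let R : (A : E →L[ℂ] F).NonlinearRightInverse :=
    { toFun := A.symm
      nnnorm := κ
      bound' := fun y => ((A.symm : F →L[ℂ] E).le_opNorm y).trans (by
        gcongr
        simp [hκ])
      right_inv' := fun y => A.apply_symm_apply y }
  -- Approximating A to within c < κ⁻¹ gives `f j` a surjectivity radius (κ⁻¹ - c)δ. Half of c is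
  -- spent on the second order error, half on the distance between the derivative of `f j` at x and
  -- A.
  set c : NNReal := κ⁻¹ / 2 with hc
  have hc0 : (0 : ℝ) < c := by positivity
  obtain ⟨δ, hδ, hδρ, hδε, hδc⟩ : ∃ δ > 0, δ < ρ ∧ δ ≤ ε ∧ C * δ ≤ c / 2 := by
    refine ⟨min (ρ / 2) (min ε (c / 2 / (C + 1))), by positivity, ?_, ?_, ?_⟩
    · exact (min_le_left _ _).trans_lt (half_lt_self hρ)
    · exact (min_le_right _ _).trans (min_le_left _ _)
    · have h1 : min (ρ / 2) (min ε ((c : ℝ) / 2 / (C + 1))) ≤ (c : ℝ) / 2 / (C + 1) :=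
        (min_le_right _ _).trans (min_le_right _ _)
      calc C * min (ρ / 2) (min ε ((c : ℝ) / 2 / (C + 1))) ≤ (C + 1) * ((c : ℝ) / 2 / (C + 1)) := by
            gcongr
            linarith
        _ = c / 2 := by field_simp
  have hder : ∀ᶠ j in l, ‖_root_.fderiv ℂ (f j) x - A‖ < c / 2 := by
    have := tendsto_iff_norm_sub_tendsto_zero.1 (hf.tendsto_fderiv hU hg hx)
    rw [← hA] at this
    exact this.eventually_lt_const (by positivity)
  have hval : ∀ᶠ j in l, ‖f j x - g x‖ < ((κ : ℝ)⁻¹ - c) * δ := by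
    refine (tendsto_iff_norm_sub_tendsto_zero.1 (hg x hx)).eventually_lt_const ?_
    refine mul_pos ?_ hδ
    have : (c : ℝ) = (κ : ℝ)⁻¹ / 2 := by simp [hc]
    rw [this]
    have := inv_pos.2 hκ0
    linarith
  filter_upwards [hj, hder, hval] with j hj1 hj2 hj3
  have happ : ApproximatesLinearOn (f j) (A : E →L[ℂ] F) (closedBall x δ) c := by
    intro y hy y' hy'
    have h1 := hj1 δ hδρ y hy y' hy'
    have h2 := (_root_.fderiv ℂ (f j) x - A).le_opNorm (y - y')
    have h3 : f j y - f j y' - (A : E →L[ℂ] F) (y - y') =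
        (f j y - f j y' - _root_.fderiv ℂ (f j) x (y - y')) +
          (_root_.fderiv ℂ (f j) x - (A : E →L[ℂ] F)) (y - y') := by
      simp
    rw [h3]
    refine (norm_add_le _ _).trans ?_
    calc _ ≤ C * δ * ‖y - y'‖ + ‖_root_.fderiv ℂ (f j) x - A‖ * ‖y - y'‖ := add_le_add h1 h2
      _ ≤ c / 2 * ‖y - y'‖ + c / 2 * ‖y - y'‖ := by gcongr
      _ = c * ‖y - y'‖ := by ring
  obtain ⟨y, hy, hyg⟩ := happ.surjOn_closedBall_of_nonlinearRightInverse R hδ.le Subset.rfl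
    (show g x ∈ closedBall (f j x) (((R.nnnorm : ℝ)⁻¹ - c) * δ) by
      rw [mem_closedBall, dist_comm, dist_eq_norm]
      exact hj3.le)
  exact ⟨y, hεN (closedBall_subset_closedBall hδε hy), hyg⟩

/-- A limit of injective holomorphic maps of a bounded domain is injective, provided that the
images contain a fixed ball around the limit value at some point. -/
theorem LocallyBddHol.exists_injective_lim {l : Ultrafilter ι} {f : ι → E → F} {U : Set E}
    (hfin : Module.finrank ℂ E = Module.finrank ℂ F) (hU : IsOpen U) (hUc : IsPreconnected U)
    (hUb : Bornology.IsBounded U) (hd : ∀ j, DifferentiableOn ℂ (f j) U)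
    (hi : ∀ j, InjOn (f j) U) (hf : LocallyBddHol l f U) {q : E} (hq : q ∈ U) {z : F} {ε : ℝ}
    (hε : 0 < ε) (hz : Tendsto (fun j => f j q) l (𝓝 z))
    (hball : ∀ᶠ j in l, ball z ε ⊆ f j '' U) :
    ∃ g : E → F, DifferentiableOn ℂ g U ∧ InjOn g U ∧
      (∀ x ∈ U, Tendsto (fun j => f j x) l (𝓝 (g x))) ∧
      ∀ x ∈ U, ∀ᶠ j in l, g x ∈ f j '' U := by
  classical
  have hex : ∀ x, ∃ y, x ∈ U → Tendsto (fun j => f j x) l (𝓝 y) := fun x => by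
    by_cases hx : x ∈ U
    · obtain ⟨y, hy⟩ := hf.exists_tendsto hx
      exact ⟨y, fun _ => hy⟩
    · exact ⟨0, fun h => absurd h hx⟩
  choose g hg using hex
  have hgd := hf.differentiableOn_lim hU hg
  obtain ⟨M, hM⟩ := hUb.exists_norm_le
  have hq' : Function.Injective (_root_.fderiv ℂ g q) := by
    -- Differentiating the identity G ∘ `f j` = id at q, with Cauchy's bound for G', gives a lower
    -- bound on the derivatives that survives in the limit.
    have hbound : ∀ᶠ j in l, ∀ v, ‖v‖ ≤ 4 * M / ε * ‖_root_.fderiv ℂ (f j) q v‖ := by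
      filter_upwards [hball, hz (ball_mem_nhds z (half_pos hε))] with j hj hjz v
      set G := Function.invFunOn (f j) U
      have hG : DifferentiableOn ℂ G (ball z ε) :=
        (differentiableOn_invFunOn hfin hU (hd j) (hi j)).mono hj
      have hGM : ∀ y ∈ ball z ε, ‖G y‖ ≤ M := fun y hy =>
        hM _ (Function.invFunOn_mem (hj hy))
      have hG' := norm_fderiv_le_of_norm_le hε hG hGM hjz
      have hGd : DifferentiableAt ℂ G (f j q) :=
        hG.differentiableAt (isOpen_ball.mem_nhds (ball_subset_ball (by linarith) hjz))
      have h1 := hGd.hasFDerivAt.comp q ((hd j).differentiableAt (hU.mem_nhds hq)).hasFDerivAt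
      have h2 : HasFDerivAt (G ∘ f j) (ContinuousLinearMap.id ℂ E) q := by
        refine (hasFDerivAt_id q).congr_of_eventuallyEq ?_
        filter_upwards [hU.mem_nhds hq] with y hy using (hi j).leftInvOn_invFunOn hy
      have h3 := DFunLike.congr_fun (h1.unique h2) v
      simp only [ContinuousLinearMap.comp_apply, ContinuousLinearMap.id_apply] at h3
      calc ‖v‖ = ‖_root_.fderiv ℂ G (f j q) (_root_.fderiv ℂ (f j) q v)‖ := by rw [h3]
        _ ≤ _ := (ContinuousLinearMap.le_opNorm _ _).trans (by gcongr)
    rw [injective_iff_map_eq_zero]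
    intro v hv
    have hlim : Tendsto (fun j => 4 * M / ε * ‖_root_.fderiv ℂ (f j) q v‖) l
        (𝓝 (4 * M / ε * ‖_root_.fderiv ℂ g q v‖)) :=
      ((((ContinuousLinearMap.apply ℂ F v).continuous.tendsto _).comp
        (hf.tendsto_fderiv hU hg hq)).norm).const_mul _
    have := ge_of_tendsto hlim (hbound.mono fun j hj => hj v)
    rw [hv, norm_zero, mul_zero] at this
    exact norm_le_zero_iff.1 this
  obtain ⟨d, hdd, hdi⟩ := exists_differentiable_det hfin
  have hg' : ∀ x ∈ U, Function.Injective (_root_.fderiv ℂ g x) := by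
    intro x hx
    rw [← hdi]
    refine ne_zero_of_tendsto (h := fun j x => d (_root_.fderiv ℂ (f j) x))
      (g := fun x => d (_root_.fderiv ℂ g x)) hU hUc
      (fun j => hdd.comp_differentiableOn (differentiableOn_fderiv hU (hd j)))
      (hf.fderiv.comp_left hdd) (fun j x hx => ?_) (fun x hx => ?_) hq ((hdi _).2 hq') x hx
    · exact (hdi _).2 (fderiv_injective_of_injOn _ E F hfin rfl hU (hd j) (hi j) x hx)
    · exact hdd.continuous.continuousAt.tendsto.comp (hf.tendsto_fderiv hU hg hx)
  have hmem : ∀ x ∈ U, ∀ N ∈ 𝓝 x, ∀ᶠ j in l, g x ∈ f j '' N := by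
    intro x hx N hN
    obtain ⟨A, hA⟩ := exists_equiv_of_injective hfin (hg' x hx)
    exact hf.eventually_mem_image hU hg hx hA hN
  refine ⟨g, hgd, ?_, hg, fun x hx => hmem x hx U (hU.mem_nhds hx)⟩
  intro x hx y hy hxy
  by_contra hne
  -- If g x = g y, one injective `f j` attains this common value in both of two disjoint
  -- neighbourhoods.
  obtain ⟨N, N', hN, hN', hdisj⟩ := t2_separation_nhds hne
  obtain ⟨j, ⟨a, ha, hax⟩, b, hb, hby⟩ := ((hmem x hx _ (inter_mem hN (hU.mem_nhds hx))).and
    (hmem y hy _ (inter_mem hN' (hU.mem_nhds hy)))).exists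
  have hab : a = b := hi j ha.2 hb.2 (by rw [hax, hby, hxy])
  exact disjoint_left.1 hdisj ha.1 (hab ▸ hb.1)

end Families

/-! ### Connectedness, homogeneity and limits of inverses -/

/-- A property that holds on all of a small ball as soon as it holds at one of its points spreads
over a connected set. -/
theorem forall_mem_of_isPreconnected {X : Type*} [PseudoMetricSpace X] {U : Set X}
    (hU : IsPreconnected U) {P : X → Prop}
    (hP : ∀ x ∈ U, ∃ η > 0, ∀ y ∈ ball x η, ∀ y' ∈ ball x η, P y → P y')
    {q : X} (hq : q ∈ U) (hPq : P q) : ∀ x ∈ U, P x := by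
  choose! η hη hηP using hP
  by_contra! hcon
  obtain ⟨x, hx, hPx⟩ := hcon
  obtain ⟨y, -, hy1, hy2⟩ := hU (⋃ a ∈ {a | a ∈ U ∧ P a}, ball a (η a))
    (⋃ a ∈ {a | a ∈ U ∧ ¬ P a}, ball a (η a))
    (isOpen_biUnion fun _ _ => isOpen_ball) (isOpen_biUnion fun _ _ => isOpen_ball)
    (fun a ha => by
      by_cases h : P a
      · exact Or.inl (mem_biUnion (show a ∈ {a | a ∈ U ∧ P a} from ⟨ha, h⟩)
          (mem_ball_self (hη a ha)))
      · exact Or.inr (mem_biUnion (show a ∈ {a | a ∈ U ∧ ¬ P a} from ⟨ha, h⟩)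
          (mem_ball_self (hη a ha))))
    ⟨q, hq, mem_biUnion (show q ∈ {a | a ∈ U ∧ P a} from ⟨hq, hPq⟩) (mem_ball_self (hη q hq))⟩
    ⟨x, hx, mem_biUnion (show x ∈ {a | a ∈ U ∧ ¬ P a} from ⟨hx, hPx⟩) (mem_ball_self (hη x hx))⟩
  obtain ⟨a, ⟨ha, hPa⟩, hya⟩ := mem_iUnion₂.1 hy1
  obtain ⟨b, ⟨hb, hPb⟩, hyb⟩ := mem_iUnion₂.1 hy2
  exact hPb (hηP b hb y hyb b (mem_ball_self (hη b hb))
    (hηP a ha a (mem_ball_self (hη a ha)) y hya hPa))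

theorem locallyBddHol_of_mapsTo_isBounded {ι : Type*} {E F : Type} [NormedAddCommGroup E]
    [NormedSpace ℂ E] [NormedAddCommGroup F] [NormedSpace ℂ F] {l : Filter ι}
    {f : ι → E → F} {U : Set E} {D : Set F} (hU : IsOpen U) (hD : Bornology.IsBounded D)
    (hf : ∀ j, HolMap U D (f j)) :
    LocallyBddHol l f U := by
  obtain ⟨M, hM⟩ := hD.exists_norm_le
  intro x hx
  obtain ⟨ε, hε, hεU⟩ := Metric.mem_nhds_iff.1 (hU.mem_nhds hx)
  exact ⟨ε, hε, M, Eventually.of_forall fun j =>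
    ⟨(hf j).1.mono hεU, fun y hy => hM _ ((hf j).2 (hεU hy))⟩⟩

section Homogeneous

variable {n : ℕ} {ι : Type*} {Ω : Set (Cn n)}

/-- On a small ball contained in all images, the inverses of a family of injective holomorphic maps
of a bounded homogeneous domain converge into the domain at every point or at none. -/
theorem tendsto_invFunOn_of_homogeneous {l : Ultrafilter ι} (hΩ : IsDomainSet Ω)
    (hb : Bornology.IsBounded Ω) (hh : IsHomogeneous Ω) {f : ι → Cn n → Cn n}
    (hd : ∀ j, DifferentiableOn ℂ (f j) Ω) (hi : ∀ j, InjOn (f j) Ω) {w : Cn n} {ε : ℝ}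
    (hε : 0 < ε) (hw : ∀ᶠ j in l, ball w ε ⊆ f j '' Ω) :
    ∃ η > 0, ∀ y ∈ ball w η, ∀ x ∈ ball w η,
      (∃ p ∈ Ω, Tendsto (fun j => Function.invFunOn (f j) Ω y) l (𝓝 p)) →
        ∃ p ∈ Ω, Tendsto (fun j => Function.invFunOn (f j) Ω x) l (𝓝 p) := by
  obtain ⟨q, hq⟩ := hΩ.2.nonempty
  obtain ⟨d, hd0, hdΩ⟩ := nhds_basis_closedBall.mem_iff.1 (hΩ.1.mem_nhds hq)
  obtain ⟨M, hM⟩ := hb.exists_norm_le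
  set C := |4 * M / ε| + 1 with hC
  have hC0 : 0 < C := by positivity
  -- Two points of this ball are at most d/C apart, so a C-Lipschitz map sending y to q sends x into
  -- the closed d-ball about q, a compact subset of Ω.
  refine ⟨min (ε / 2) (d / (2 * C)), by positivity, ?_⟩
  rintro y hy x hx ⟨p, hp, hyp⟩
  have hyε := ball_subset_ball (min_le_left _ _) hy
  have hxε := ball_subset_ball (min_le_left _ _) hx
  have hxy : ‖x - y‖ ≤ d / C := by
    have h1 := mem_ball.1 (ball_subset_ball (min_le_right _ _) hy)
    have h2 := mem_ball.1 (ball_subset_ball (min_le_right _ _) hx)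
    rw [← dist_eq_norm]
    have h3 := dist_triangle_right x y w
    have h4 : d / C = d / (2 * C) + d / (2 * C) := by
      field_simp
      norm_num
    linarith
  set G := fun j => Function.invFunOn (f j) Ω with hG
  have haut : ∀ j, ∃ τ σ : Cn n → Cn n, HolMap Ω Ω τ ∧ HolMap Ω Ω σ ∧ InvOn σ τ Ω Ω ∧
      (G j y ∈ Ω → τ (G j y) = q) := by
    intro j
    by_cases hj : G j y ∈ Ω
    · obtain ⟨τ, ⟨hτ, σ, hσ, hinv⟩, hτq⟩ := hh _ hj q hq
      exact ⟨τ, σ, hτ, hσ, hinv, fun _ => hτq⟩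
    · obtain ⟨τ, ⟨hτ, σ, hσ, hinv⟩, -⟩ := hh q hq q hq
      exact ⟨τ, σ, hτ, hσ, hinv, fun h => absurd h hj⟩
  choose τ σ hτ hσ hinv hτq using haut
  have hGΩ : ∀ᶠ j in l, ∀ u ∈ ball w ε, G j u ∈ Ω := by
    filter_upwards [hw] with j hj u hu using Function.invFunOn_mem (hj hu)
  have hyball : y ∈ ball w ε := ball_subset_ball (by linarith) hyε
  have hxball : x ∈ ball w ε := ball_subset_ball (by linarith) hxε
  have hσimage : ∀ j, σ j '' Ω = Ω := fun j =>
    Subset.antisymm (hσ j).2.image_subset fun u hu => ⟨τ j u, (hτ j).2 hu, (hinv j).1 hu⟩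
  have hσq : ∀ᶠ j in l, σ j q = G j y := by
    filter_upwards [hGΩ] with j hj
    rw [← hτq j (hj y hyball)]
    exact (hinv j).1 (hj y hyball)
  obtain ⟨ε', hε', hεp⟩ := Metric.mem_nhds_iff.1 (hΩ.1.mem_nhds hp)
  have hσb : LocallyBddHol (l : Filter ι) σ Ω := locallyBddHol_of_mapsTo_isBounded hΩ.1 hb hσ
  -- `σ j q` = `G j y` tends to p, and every `σ j` maps onto Ω, which contains a ball about p; so
  -- the automorphisms have a nondegenerate limit s into Ω. Then `G j x`, the image under `σ j` of a
  -- sequence tending to k, converges to s k.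
  obtain ⟨s, -, -, hslim, hsmem⟩ := hσb.exists_injective_lim rfl hΩ.1 hΩ.2.isPreconnected hb
    (fun j => (hσ j).1) (fun j => LeftInvOn.injOn (hinv j).2) hq hε'
    (hyp.congr' (hσq.mono fun j hj => hj.symm))
    (Eventually.of_forall fun j => by rw [hσimage]; exact hεp)
  have hk : ∀ᶠ j in l, τ j (G j x) ∈ closedBall q d := by
    filter_upwards [hGΩ, hw] with j hj hjw
    have hdiff : DifferentiableOn ℂ (fun u => τ j (G j u)) (ball w ε) :=
      (hτ j).1.comp ((differentiableOn_invFunOn rfl hΩ.1 (hd j) (hi j)).mono hjw) hj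
    have h1 := dist_le_of_norm_le hε hdiff (fun u hu => hM _ ((hτ j).2 (hj u hu))) hxε hyε
    rw [hτq j (hj y hyball)] at h1
    rw [mem_closedBall, dist_eq_norm]
    refine h1.trans ?_
    calc 4 * M / ε * ‖x - y‖ ≤ C * (d / C) := by
          gcongr
          rw [hC]
          linarith [le_abs_self (4 * M / ε)]
      _ = d := by field_simp
  have : ProperSpace (Cn n) := FiniteDimensional.proper ℂ _
  obtain ⟨k, hkd, hkl⟩ := exists_tendsto_of_isCompact l (isCompact_closedBall q d) hk
  have hkΩ : k ∈ Ω := hdΩ hkd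
  refine ⟨s k, ?_, ?_⟩
  · obtain ⟨j, hj⟩ := (hsmem k hkΩ).exists
    rwa [hσimage] at hj
  · refine (hσb.tendsto_of_tendsto hkΩ (hslim k hkΩ) hkl).congr' ?_
    filter_upwards [hGΩ] with j hj
    exact (hinv j).1 (hj x hxball)

/-- Injective holomorphic maps of a bounded homogeneous domain have a limit whose image contains
every connected open set that is locally contained in the images. -/
theorem exists_injective_lim_of_homogeneous {l : Ultrafilter ι} (hΩ : IsDomainSet Ω)
    (hb : Bornology.IsBounded Ω) (hh : IsHomogeneous Ω) {f : ι → Cn n → Cn n}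
    (hd : ∀ j, DifferentiableOn ℂ (f j) Ω) (hi : ∀ j, InjOn (f j) Ω)
    (hf : LocallyBddHol l f Ω) {q z : Cn n} (hq : q ∈ Ω) (hz : ∀ j, f j q = z) {W : Set (Cn n)}
    (hWc : IsPreconnected W) (hzW : z ∈ W)
    (hW : ∀ w ∈ W, ∃ ε > 0, ∀ᶠ j in l, ball w ε ⊆ f j '' Ω) :
    ∃ g : Cn n → Cn n, DifferentiableOn ℂ g Ω ∧ InjOn g Ω ∧
      (∀ x ∈ Ω, ∀ᶠ j in l, g x ∈ f j '' Ω) ∧ W ⊆ g '' Ω := by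
  obtain ⟨ε, hε, hεz⟩ := hW z hzW
  obtain ⟨g, hgd, hgi, hglim, hgmem⟩ :=
    hf.exists_injective_lim rfl hΩ.1 hΩ.2.isPreconnected hb hd hi
    hq hε (by simp only [hz]; exact tendsto_const_nhds) hεz
  refine ⟨g, hgd, hgi, hgmem, fun w hw => ?_⟩
  obtain ⟨p, hp, hpl⟩ := forall_mem_of_isPreconnected hWc
    (P := fun w => ∃ p ∈ Ω, Tendsto (fun j => Function.invFunOn (f j) Ω w) l (𝓝 p))
    (fun w hw => by
      obtain ⟨ε, hε, hεw⟩ := hW w hw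
      exact tendsto_invFunOn_of_homogeneous hΩ hb hh hd hi hε hεw) hzW
    ⟨q, hq, tendsto_const_nhds.congr fun j => by
      rw [← hz j]
      exact ((hi j).leftInvOn_invFunOn hq).symm⟩ w hw
  refine ⟨p, hp, ?_⟩
  have h1 := hf.tendsto_of_tendsto hp (hglim p hp) hpl
  refine tendsto_nhds_unique h1 (tendsto_const_nhds.congr' ?_)
  obtain ⟨ε, hε, hεw⟩ := hW w hw
  filter_upwards [hεw] with j hj
  exact (Function.invFunOn_eq (hj (mem_ball_self hε))).symm

end Homogeneous

/-! ### Local bounds from tautness -/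

section Taut

variable {n : ℕ} {D : Set (Cn n)}

/-- Convergence of the centres to a point of D excludes compact divergence: the centres together
with their limit form a compact subset of D. -/
theorem IsTaut.exists_tendsto (hD : IsTaut D) {φ : ℕ → ℂ → Cn n} (hφ : ∀ j, HolMap disc D (φ j))
    {p : Cn n} (hp : p ∈ D) (hlim : Tendsto (fun j => φ j 0) atTop (𝓝 p)) {ζ : ℂ}
    (hζ : ζ ∈ disc) :
    ∃ s : ℕ → ℕ, StrictMono s ∧ ∃ y ∈ D, Tendsto (fun j => φ (s j) ζ) atTop (𝓝 y) := by
  obtain ⟨s, hs, ⟨ψ, hψ, hψl⟩ | hdiv⟩ := hD φ hφ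
  · exact ⟨s, hs, ψ ζ, hψ.2 hζ, hψl.tendsto_at hζ⟩
  · exfalso
    have h0 : (0 : ℂ) ∈ disc := mem_ball_self one_pos
    have := hdiv {0} isCompact_singleton (by simp)
      (insert p (range fun j => φ j 0)) hlim.isCompact_insert_range
      (insert_subset hp (range_subset_iff.2 fun j => (hφ j).2 h0))
    obtain ⟨j, hj⟩ := this.exists
    exact disjoint_left.1 hj (mem_image_of_mem _ rfl) (mem_insert_of_mem _ ⟨s j, rfl⟩)

theorem holMap_comp_line {Ω : Set (Cn n)} {f : Cn n → Cn n} (hf : HolMap Ω D f) {x w : Cn n}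
    {r : ℝ} (hr : 0 < r) (hrΩ : ball x r ⊆ Ω) (hw : ‖w‖ ≤ r) :
    HolMap disc D fun ζ : ℂ => f (x + ζ • w) := by
  have hmem : MapsTo (fun ζ : ℂ => x + ζ • w) disc Ω := by
    intro ζ hζ
    refine hrΩ ?_
    rw [mem_ball_zero_iff] at hζ
    rw [mem_ball, dist_eq_norm, add_sub_cancel_left, norm_smul]
    calc ‖ζ‖ * ‖w‖ ≤ ‖ζ‖ * r := by gcongr
      _ < 1 * r := by gcongr
      _ = r := one_mul r
  exact ⟨hf.1.comp (by fun_prop) hmem, hf.2.comp hmem⟩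

/-- Holomorphic maps into a taut domain with a common value are locally uniformly bounded. -/
theorem IsTaut.locallyBddHol {l : Filter ℕ} (hD : IsTaut D) {Ω : Set (Cn n)}
    (hΩ : IsDomainSet Ω) {f : ℕ → Cn n → Cn n} (hf : ∀ j, HolMap Ω D (f j)) {q z : Cn n}
    (hq : q ∈ Ω) (hz : z ∈ D) (hfq : ∀ j, f j q = z) : LocallyBddHol l f Ω := by
  have hhalf : (1 / 2 : ℂ) ∈ disc := by
    rw [mem_ball_zero_iff]
    norm_num
  -- The property spreads from y to y' because y' is at parameter 1/2 of a disc centred at y. The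
  -- index sequence s is arbitrary, as the indices in the contradiction below need not increase.
  have hlim : ∀ x ∈ Ω, ∀ s : ℕ → ℕ, ∃ t : ℕ → ℕ, StrictMono t ∧
      ∃ p ∈ D, Tendsto (fun j => f (s (t j)) x) atTop (𝓝 p) := by
    refine forall_mem_of_isPreconnected hΩ.2.isPreconnected (fun x hx => ?_) hq fun s =>
      ⟨id, strictMono_id, z, hz, by simp only [hfq]; exact tendsto_const_nhds⟩
    obtain ⟨r, hr, hrΩ⟩ := Metric.mem_nhds_iff.1 (hΩ.1.mem_nhds hx)
    refine ⟨r / 8, by positivity, fun y hy y' hy' hPy s => ?_⟩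
    obtain ⟨t, ht, p, hp, htp⟩ := hPy s
    have hsub : ball y (r / 2) ⊆ Ω :=
      (ball_subset_ball' (by linarith [mem_ball.1 hy])).trans hrΩ
    have hw : ‖(2 : ℂ) • (y' - y)‖ ≤ r / 2 := by
      have h1 := dist_triangle_right y' y x
      rw [norm_smul, ← dist_eq_norm]
      have := mem_ball.1 hy
      have := mem_ball.1 hy'
      norm_num
      linarith
    obtain ⟨t', ht', p', hp', hlim⟩ := hD.exists_tendsto
      (fun j => holMap_comp_line (hf (s (t j))) (half_pos hr) hsub hw) hp (by simpa using htp) hhalf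
    refine ⟨t ∘ t', ht.comp ht', p', hp', ?_⟩
    simpa [smul_smul] using hlim
  intro x hx
  obtain ⟨r, hr, hrΩ⟩ := Metric.mem_nhds_iff.1 (hΩ.1.mem_nhds hx)
  -- Points with ever larger values are placed at parameter 1/2 of discs centred at x, whose
  -- directions vary with the index.
  obtain ⟨M, hM⟩ : ∃ M : ℝ, ∀ j, ∀ y ∈ ball x (r / 2), ‖f j y‖ ≤ M := by
    by_contra! hcon
    choose s y hy hsy using fun k : ℕ => hcon k
    obtain ⟨t, ht, p, hp, htp⟩ := hlim x hx s
    have hw : ∀ k, ‖(2 : ℂ) • (y k - x)‖ ≤ r := by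
      intro k
      have := mem_ball.1 (hy k)
      rw [norm_smul, ← dist_eq_norm]
      norm_num
      linarith
    obtain ⟨t', ht', p', -, hlim'⟩ := hD.exists_tendsto
      (fun j => holMap_comp_line (hf (s (t j))) hr hrΩ (hw (t j))) hp (by simpa using htp) hhalf
    have hlim'' : Tendsto (fun j => f (s (t (t' j))) (y (t (t' j)))) atTop (𝓝 p') := by
      simpa [smul_smul] using hlim'
    refine not_tendsto_atTop_of_tendsto_nhds hlim''.norm ?_
    exact tendsto_atTop_mono (fun j => (hsy (t (t' j))).le)
      (tendsto_natCast_atTop_atTop.comp (ht.comp ht').tendsto_atTop)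
  refine ⟨r / 2, half_pos hr, M, Eventually.of_forall fun j => ⟨(hf j).1.mono ?_, hM j⟩⟩
  exact (ball_subset_ball (by linarith)).trans hrΩ

end Taut

/-! ### Topology of Kobayashi balls -/

section Kobayashi

variable {n : ℕ} {D : Set (Cn n)}

theorem kobayashi_self (D : Set (Cn n)) (z : Cn n) : kobayashi D z z = 0 :=
  nonpos_iff_eq_zero.1 (sInf_le ⟨0, fun _ => z, rfl, rfl, by simp⟩)

theorem kobayashi_le_sum (D : Set (Cn n)) (c : ℕ → Cn n) (m : ℕ) :
    kobayashi D (c 0) (c m) ≤ ∑ i ∈ Finset.range m, lempert D (c i) (c (i + 1)) :=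
  sInf_le ⟨m, c, rfl, rfl, rfl⟩

theorem kobayashi_le_add_lempert (D : Set (Cn n)) (z w w' : Cn n) :
    kobayashi D z w' ≤ kobayashi D z w + lempert D w w' := by
  rw [kobayashi, kobayashi, ENNReal.sInf_add]
  refine le_iInf₂ ?_
  rintro _ ⟨m, c, rfl, rfl, rfl⟩
  refine sInf_le ⟨m + 1, fun i => if i ≤ m then c i else w', by simp, by simp, ?_⟩
  rw [Finset.sum_range_succ]
  congr 1
  · refine Finset.sum_congr rfl fun i hi => ?_
    have := Finset.mem_range.1 hi
    simp [this.le, Nat.succ_le_of_lt this]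
  · simp

theorem lempert_le_of_holMap {φ : ℂ → Cn n} (hφ : HolMap disc D φ) {a b : ℂ} (ha : a ∈ disc)
    (hb : b ∈ disc) : lempert D (φ a) (φ b) ≤ ENNReal.ofReal (poincareDist a b) :=
  sInf_le ⟨φ, a, ha, b, hb, hφ, rfl, rfl, rfl⟩

theorem lempert_le_of_ball_subset {w w' : Cn n} {ε : ℝ} (hε : 0 < ε) (hD : ball w ε ⊆ D)
    (hw' : w' ∈ ball w ε) : lempert D w w' ≤ ENNReal.ofReal (Real.artanh (‖w' - w‖ / ε)) := by
  rw [mem_ball, dist_eq_norm] at hw'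
  -- If w' = w, division by zero makes u = 0, and the disc is constant.
  set u : Cn n := ((ε / ‖w' - w‖ : ℝ) : ℂ) • (w' - w) with hu
  have hunorm : ‖u‖ ≤ ε := by
    rw [hu, norm_smul, Complex.norm_real, Real.norm_of_nonneg (by positivity)]
    rcases eq_or_ne ‖w' - w‖ 0 with h | h
    · simp [h, hε.le]
    · rw [div_mul_cancel₀ _ h]
  have hb : ‖(((‖w' - w‖ / ε : ℝ)) : ℂ)‖ = ‖w' - w‖ / ε := by
    rw [Complex.norm_real, Real.norm_of_nonneg (by positivity)]
  have hφ := holMap_comp_line (D := D) (f := id) ⟨differentiableOn_id, fun x hx => hD hx⟩ hε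
    Subset.rfl hunorm
  have h := lempert_le_of_holMap hφ (a := 0) (b := ((‖w' - w‖ / ε : ℝ) : ℂ))
    (mem_ball_self one_pos) (by
      rw [mem_ball_zero_iff, hb]
      exact (div_lt_one hε).2 hw')
  have h1 : w + (((‖w' - w‖ / ε : ℝ)) : ℂ) • u = w' := by
    rcases eq_or_ne (‖w' - w‖) 0 with h0 | h0
    · rw [hu, sub_eq_zero.1 (norm_eq_zero.1 h0)]
      simp
    · rw [hu, smul_smul, ← Complex.ofReal_mul,
        show ‖w' - w‖ / ε * (ε / ‖w' - w‖) = 1 by field_simp]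
      simp
  have h2 : ∀ b : ℂ, poincareDist 0 b = Real.artanh ‖b‖ := fun b => by simp [poincareDist]
  rw [h2, hb] at h
  simpa only [id, zero_smul, add_zero, h1] using h

theorem exists_ball_subset_kobBall (hD : IsOpen D) {z w : Cn n} {s : ℝ≥0∞}
    (hw : w ∈ kobBall D z s) : ∃ ε > 0, ball w ε ⊆ kobBall D z s := by
  obtain ⟨ε, hε, hεD⟩ := Metric.mem_nhds_iff.1 (hD.mem_nhds hw.1)
  obtain ⟨t, ht, hts⟩ : ∃ t : ℝ, 0 < t ∧ kobayashi D z w + ENNReal.ofReal t < s := by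
    obtain ⟨r, hr, hrs⟩ := ENNReal.lt_iff_exists_add_pos_lt.1 hw.2
    exact ⟨r, hr, by simpa using hrs⟩
  have htanh : 0 < Real.tanh t := by
    rw [Real.tanh_eq_sinh_div_cosh]
    exact div_pos (Real.sinh_pos_iff.2 ht) (Real.cosh_pos t)
  have htanh1 : Real.tanh t < 1 := Real.tanh_lt_one t
  -- The affine disc of radius ε reaches points within ε tanh t at Poincaré distance at most the
  -- slack t.
  refine ⟨ε * Real.tanh t, by positivity, fun w' hw' => ?_⟩
  have hw'ε : w' ∈ ball w ε := ball_subset_ball (by nlinarith) hw'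
  refine ⟨hεD hw'ε, (kobayashi_le_add_lempert D z w w').trans_lt (lt_of_le_of_lt ?_ hts)⟩
  gcongr
  refine (lempert_le_of_ball_subset hε hεD hw'ε).trans (ENNReal.ofReal_le_ofReal ?_)
  rw [mem_ball, dist_eq_norm] at hw'
  rw [← Real.artanh_tanh t]
  refine Real.artanh_le_artanh ?_ htanh1 ?_
  · have : 0 ≤ ‖w' - w‖ / ε := by positivity
    linarith
  · refine (div_le_iff₀ hε).2 (hw'.le.trans_eq ?_)
    rw [mul_comm]

/-- The involutive automorphism of the unit disc that exchanges `0` and `a`. -/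
noncomputable def discInvolution (a ζ : ℂ) : ℂ := (a - ζ) / (1 - conj a * ζ)

theorem one_sub_conj_mul_ne_zero {a ζ : ℂ} (ha : a ∈ disc) (hζ : ζ ∈ disc) :
    1 - conj a * ζ ≠ 0 := by
  rw [mem_ball_zero_iff] at ha hζ
  intro h
  have h1 : ‖conj a * ζ‖ = 1 := by rw [← sub_eq_zero.1 h, norm_one]
  rw [norm_mul, RCLike.norm_conj] at h1
  nlinarith [norm_nonneg a, norm_nonneg ζ]

theorem discInvolution_mem {a ζ : ℂ} (ha : a ∈ disc) (hζ : ζ ∈ disc) :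
    discInvolution a ζ ∈ disc := by
  have h0 := one_sub_conj_mul_ne_zero ha hζ
  rw [mem_ball_zero_iff] at *
  rw [discInvolution, norm_div, div_lt_one (norm_pos_iff.2 h0)]
  refine lt_of_pow_lt_pow_left₀ 2 (norm_nonneg _) ?_
  have h1 : ‖1 - conj a * ζ‖ ^ 2 - ‖a - ζ‖ ^ 2 = (1 - ‖a‖ ^ 2) * (1 - ‖ζ‖ ^ 2) := by
    simp only [← Complex.normSq_eq_norm_sq, Complex.normSq_apply]
    simp
    ring
  have h2 : 0 < (1 - ‖a‖ ^ 2) * (1 - ‖ζ‖ ^ 2) := by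
    refine mul_pos ?_ ?_ <;> nlinarith [norm_nonneg a, norm_nonneg ζ]
  linarith

theorem discInvolution_discInvolution {a ζ : ℂ} (ha : a ∈ disc) (hζ : ζ ∈ disc) :
    discInvolution a (discInvolution a ζ) = ζ := by
  have h0 := one_sub_conj_mul_ne_zero ha hζ
  have h1 := one_sub_conj_mul_ne_zero ha (discInvolution_mem ha hζ)
  have h2 : discInvolution a ζ * (1 - conj a * ζ) = a - ζ := div_mul_cancel₀ _ h0
  rw [discInvolution, div_eq_iff h1]
  linear_combination -h2

/-- A Kobayashi ball is connected. -/
theorem isPreconnected_kobBall {z : Cn n} (hz : z ∈ D) (R : ℝ≥0∞) :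
    IsPreconnected (kobBall D z R) := by
  have key : ∀ (c : ℕ → Cn n) (m : ℕ), c 0 = z →
      ∑ i ∈ Finset.range m, lempert D (c i) (c (i + 1)) < R →
      ∃ t ⊆ kobBall D z R, z ∈ t ∧ c m ∈ t ∧ IsPreconnected t := by
    intro c m hc
    induction m with
    | zero =>
      intro hR
      refine ⟨{z}, ?_, rfl, hc, isPreconnected_singleton⟩
      rw [singleton_subset_iff]
      exact ⟨hz, by simpa [kobayashi_self] using hR⟩
    | succ m ih =>
      intro hR
      rw [Finset.sum_range_succ] at hR
      obtain ⟨t, htR, hzt, hct, ht⟩ := ih (lt_of_le_of_lt le_self_add hR)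
      rw [lempert, ENNReal.add_sInf] at hR
      simp only [iInf_lt_iff] at hR
      obtain ⟨_, ⟨φ, a, ha, b, hb, hφ, hφa, hφb, rfl⟩, hR⟩ := hR
      -- The involution carries the segment from 0 to β to the geodesic from a to b. Its points are
      -- no farther from a than b is, so their image under φ stays in the ball.
      set β := discInvolution a b with hβ
      have hβd : β ∈ disc := discInvolution_mem ha hb
      have hsβ : ∀ s ∈ Icc (0 : ℝ) 1, (s : ℂ) * β ∈ disc := by
        intro s hs
        rw [mem_ball_zero_iff] at *
        rw [norm_mul, Complex.norm_real, Real.norm_of_nonneg hs.1]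
        nlinarith [hs.1, hs.2, norm_nonneg β]
      have hγc : ContinuousOn (fun s : ℝ => φ (discInvolution a (s * β))) (Icc 0 1) := by
        refine hφ.1.continuousOn.comp ?_ fun s hs => discInvolution_mem ha (hsβ s hs)
        unfold discInvolution
        refine ContinuousOn.div (by fun_prop) (by fun_prop) fun s hs =>
          one_sub_conj_mul_ne_zero ha (hsβ s hs)
      have h0 : φ (discInvolution a (((0 : ℝ) : ℂ) * β)) = c m := by
        rw [← hφa]
        simp [discInvolution]
      have h1 : φ (discInvolution a (((1 : ℝ) : ℂ) * β)) = c (m + 1) := by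
        rw [← hφb, Complex.ofReal_one, one_mul, hβ, discInvolution_discInvolution ha hb]
      refine ⟨t ∪ (fun s : ℝ => φ (discInvolution a (s * β))) '' Icc 0 1, ?_, Or.inl hzt,
        Or.inr ⟨1, by simp, h1⟩, ?_⟩
      · refine union_subset htR ?_
        rintro _ ⟨s, hs, rfl⟩
        have hsd := discInvolution_mem ha (hsβ s hs)
        refine ⟨hφ.2 hsd, lt_of_le_of_lt ?_ hR⟩
        refine (kobayashi_le_add_lempert D z (c m) _).trans ?_
        gcongr
        · rw [← hc]
          exact kobayashi_le_sum D c m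
        · rw [← hφa]
          refine (lempert_le_of_holMap hφ ha hsd).trans (ENNReal.ofReal_le_ofReal ?_)
          have h2 : poincareDist a (discInvolution a (s * β)) = Real.artanh ‖(s : ℂ) * β‖ := by
            change Real.artanh ‖discInvolution a (discInvolution a (s * β))‖ = _
            rw [discInvolution_discInvolution ha (hsβ s hs)]
          have h3 : poincareDist a b = Real.artanh ‖β‖ := rfl
          rw [h2, h3]
          rw [mem_ball_zero_iff] at hβd
          refine Real.artanh_le_artanh (by linarith [norm_nonneg ((s : ℂ) * β)]) hβd ?_
          rw [norm_mul, Complex.norm_real, Real.norm_of_nonneg hs.1]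
          exact mul_le_of_le_one_left (norm_nonneg _) hs.2
      · exact ht.union (c m) hct ⟨0, by simp, h0⟩ (isPreconnected_Icc.image _ hγc)
  refine isPreconnected_of_forall z fun w hw => ?_
  obtain ⟨_, ⟨m, c, hc0, hcm, rfl⟩, hR⟩ := sInf_lt_iff.1 hw.2
  obtain ⟨t, h1, h2, h3, h4⟩ := key c m hc0 hR
  exact ⟨t, h1, h2, hcm ▸ h3, h4⟩

end Kobayashi

/-! ### The Fridman invariant and the extremal map -/

theorem arctanhExt_tanhExt (t : ℝ≥0∞) : arctanhExt (tanhExt t) = t := by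
  unfold arctanhExt tanhExt
  by_cases ht : t = ∞
  · simp [ht]
  · rw [if_neg ht, if_neg (Real.tanh_lt_one _).ne, Real.artanh_tanh, ENNReal.ofReal_toReal ht]

theorem arctanhExt_fridmanE {n : ℕ} (D Ω : Set (Cn n)) (z : Cn n) :
    arctanhExt (fridmanE D Ω z) = (fridmanH D Ω z)⁻¹ :=
  arctanhExt_tanhExt _

theorem nonempty_of_sInf_ne_top {S : Set ℝ≥0∞} (h : sInf S ≠ ∞) : S.Nonempty :=
  nonempty_iff_ne_empty.2 fun hS => h (by rw [hS, sInf_empty])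

/-- A bounded set has a small homothetic image inside any open set. -/
theorem exists_injHolMap {n : ℕ} {D Ω : Set (Cn n)} (hD : IsOpen D) {z : Cn n} (hz : z ∈ D)
    (hΩ : Bornology.IsBounded Ω) : ∃ f, InjHolMap Ω D f := by
  obtain ⟨ε, hε, hεD⟩ := Metric.mem_nhds_iff.1 (hD.mem_nhds hz)
  obtain ⟨M, hM0, hM⟩ := hΩ.exists_pos_norm_lt
  have hc : 0 < ε / M := by positivity
  refine ⟨fun x => z + ((ε / M : ℝ) : ℂ) • x, ⟨by fun_prop, fun x hx => hεD ?_⟩, ?_⟩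
  · rw [mem_ball, dist_eq_norm, add_sub_cancel_left, norm_smul, Complex.norm_real,
      Real.norm_of_nonneg hc.le]
    calc ε / M * ‖x‖ < ε / M * M := by
          gcongr
          exact hM x hx
      _ = ε := by field_simp
  · intro x _ y _ hxy
    exact smul_right_injective _ (Complex.ofReal_ne_zero.2 hc.ne') (add_left_cancel hxy)

/-- A Fridman competitor of radius `r` normalized at a given base point of the model. -/
theorem exists_normalized {n : ℕ} {D Ω : Set (Cn n)} (hΩh : IsHomogeneous Ω) {z q : Cn n}
    (hz : z ∈ D) (hq : q ∈ Ω) {r : ℝ} (hr : 0 < r) {f : Cn n → Cn n} (hf : InjHolMap Ω D f)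
    (hfr : kobBall D z (ENNReal.ofReal r) ⊆ f '' Ω) :
    ∃ F, InjHolMap Ω D F ∧ kobBall D z (ENNReal.ofReal r) ⊆ F '' Ω ∧ F q = z := by
  obtain ⟨p, hp, hpz⟩ := hfr ⟨hz, by rw [kobayashi_self]; exact ENNReal.ofReal_pos.2 hr⟩
  obtain ⟨τ, ⟨hτ, σ, hσ, hinv⟩, hτq⟩ := hΩh q hq p hp
  refine ⟨f ∘ τ, ⟨⟨hf.1.1.comp hτ.1 hτ.2, hf.1.2.comp hτ.2⟩, hf.2.comp hinv.1.injOn hτ.2⟩, ?_, ?_⟩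
  · intro w hw
    obtain ⟨x, hx, rfl⟩ := hfr hw
    exact ⟨σ x, hσ.2 hx, congrArg f (hinv.2 hx)⟩
  · rw [Function.comp_apply, hτq, hpz]

end Fridman

theorem mainTheorem1 {n : ℕ} (D Ω : Set (Fridman.Cn n))
    (hD : Fridman.IsDomainSet D) (hDhyp : Fridman.IsKobHyperbolic D)
    (hDbt : Bornology.IsBounded D ∨ Fridman.IsTaut D)
    (hΩ : Fridman.IsDomainSet Ω) (hΩb : Bornology.IsBounded Ω)
    (hΩh : Fridman.IsHomogeneous Ω) (z : Fridman.Cn n) (hz : z ∈ D) :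
    ∃ f : Fridman.Cn n → Fridman.Cn n, Fridman.IsExtremalMap D Ω z f := by
  simp only [Fridman.IsExtremalMap, Fridman.arctanhExt_fridmanE]
  -- The radius is then 0 and the ball empty, so any embedding of Ω will do.
  by_cases htop : Fridman.fridmanH D Ω z = ∞
  · obtain ⟨f, hf⟩ := Fridman.exists_injHolMap hD.1 hz hΩb
    exact ⟨f, hf, fun w hw => absurd hw.2 (by simp [htop])⟩
  obtain ⟨q, hq⟩ := hΩ.2.nonempty
  obtain ⟨t, -, htlim, ht⟩ := exists_seq_tendsto_sInf (Fridman.nonempty_of_sInf_ne_top htop)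
    (OrderBot.bddBelow _)
  have hcomp : ∀ j, ∃ r : ℝ, ∃ F, t j = ENNReal.ofReal (1 / r) ∧ 0 < r ∧
      Fridman.InjHolMap Ω D F ∧ Fridman.kobBall D z (ENNReal.ofReal r) ⊆ F '' Ω ∧ F q = z := by
    intro j
    obtain ⟨r, hr, f, hf, hfr, htr⟩ := ht j
    obtain ⟨F, hF⟩ := Fridman.exists_normalized hΩh hz hq hr hf hfr
    exact ⟨r, F, htr, hr, hF⟩
  choose r F htr hr hF hFr hFq using hcomp
  have hrlim : Tendsto (fun j => ENNReal.ofReal (r j)) atTop (𝓝 (Fridman.fridmanH D Ω z)⁻¹) := by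
    refine (tendsto_inv_iff.2 htlim).congr fun j => ?_
    rw [htr j, one_div, ENNReal.ofReal_inv_of_pos (hr j), inv_inv]
  have hloc : Fridman.LocallyBddHol (hyperfilter ℕ : Filter ℕ) F Ω := by
    rcases hDbt with hb | htaut
    · exact Fridman.locallyBddHol_of_mapsTo_isBounded hΩ.1 hb fun j => (hF j).1
    · exact htaut.locallyBddHol hΩ (fun j => (hF j).1) hq hz hFq
  obtain ⟨g, hgd, hgi, hgmem, hgW⟩ := Fridman.exists_injective_lim_of_homogeneous hΩ hΩb hΩh
    (fun j => (hF j).1.1) (fun j => (hF j).2) hloc hq hFq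
    (Fridman.isPreconnected_kobBall hz (Fridman.fridmanH D Ω z)⁻¹)
    ⟨hz, by simpa [Fridman.kobayashi_self, pos_iff_ne_zero] using htop⟩ (fun w hw => by
      -- The strict inequality leaves room for r j to exceed s eventually, even if r j < R
      -- throughout or R = ∞.
      obtain ⟨s, hws, hsR⟩ := exists_between hw.2
      obtain ⟨ε, hε, hεs⟩ := Fridman.exists_ball_subset_kobBall hD.1
        (show w ∈ Fridman.kobBall D z s from ⟨hw.1, hws⟩)
      refine ⟨ε, hε, ?_⟩
      filter_upwards [Nat.hyperfilter_le_atTop (hrlim.eventually_const_lt hsR)] with j hj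
      exact fun x hx => hFr j ⟨(hεs hx).1, (hεs hx).2.trans hj⟩)
  refine ⟨g, ⟨⟨hgd, fun x hx => ?_⟩, hgi⟩, hgW⟩
  -- The value g x is attained by some `F j`, hence lies in D itself and not merely in its closure.
  obtain ⟨j, y, hy, hyx⟩ := (hgmem x hx).exists
  exact hyx ▸ (hF j).1.2 hy
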